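/- Let $d\in\mathbb N$, $d\ge 1$. Let $\mu$ be a probability measure on $\mathbb R$ with bounded support and with a density $\rho\in\mathrm{BV}(\mathbb R)$, i.e. $\rho\in L^1(\mathbb R)$ and the distributional derivative of $\rho$ is a finite signed Borel measure. Let $\Omega=\prod_{k\in\mathbb Z^d}\operatorname{supp}\mu$ with the product $\sigma$-algebra and $\mathbb P=\bigotimes_{k\in\mathbb Z^d}\mu$. Let $u:\mathbb Z^d\to\mathbb R$, $u\not\equiv 0$, satisfy $|u(k)|\le C\mathrm e^{-\alpha\|k\|_1}$ for all $k\in\mathbb Z^d$ with some constants $C,\alpha>0$. For $\omega\in\Omega$ let $h_\omega=h_0+v_\omega$ on $\ell^2(\mathbb Z^d)$, where $(h_0\psi)(x)=\sum_{\|x-y\|_1=1}(\psi(x)-\psi(y))$ and $v_\omega$ is multiplication by $v_\omega(x)=\sum_{k\in\mathbb Z^d}\omega_k u(x-k)$. For real $l>0$ and $x\in\mathbb Z^d$ let $\mathfrak C_l(x)=([-l,l]^d+x)\cap\mathbb Z^d$, and let $h_\omega^{\mathfrak C_l(x)}$ be the compression of $h_\omega$ to $\ell^2(\mathfrak C_l(x))$.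 For $m>0$ and $E\in\mathbb R$ the cube $\mathfrak C_l(x)$ is called $(m,E)$-regular for $\omega$ if $E\notin\sigma(h_\omega^{\mathfrak C_l(x)})$ and $|\langle\delta_x,(h_\omega^{\mathfrak C_l(x)}-E)^{-1}\delta_w\rangle|\le \mathrm e^{-ml}$ for all $w$ in the interior boundary of $\mathfrak C_l(x)$, i.e. for all $w\in\mathfrak C_l(x)$ having fewer than $2d$ nearest neighbours in $\mathfrak C_l(x)$. It is called uniformly $(m,E)$-regular for $\omega$ if it is $(m,E)$-regular for every $\omega'\in\Omega$ with $\omega'_k=\omega_k$ for all $k\in\mathfrak C_{4l}(x)$. For an interval $I\subset\mathbb R$ let \[B_l(z_1,z_2,m,I)=\{\omega\in\Omega:\ \exists E\in I:\ \mathfrak C_l(z_1)\text{ and }\mathfrak C_l(z_2)\text{ are both not uniformly }(m,E)\text{-regular}\}.\] For $\xi>0$ we say that $G(I,l,m,\xi)$ is satisfied if $\mathbb P(B_l(z_1,z_2,m,I)^{\mathrm c})\ge 1-l^{-2\xi}$ for all $z_1,z_2\in\mathbb Z^d$ with $\|z_1-z_2\|_\infty>8l$. **Theorem.** Fix $\xi>2d$,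 $\kappa\in(1,2\xi/(\xi+2d))$ and $\beta\in(2-\kappa,1)$. Then there is $l^*=l^*(d,\xi,\kappa,\beta,u,\rho)\ge 1$ such that for every interval $I\subset\mathbb R$, every real $l\ge l^*$ and every $m>l^{\beta-1}$: if $G(I,l,m,\xi)$ is satisfied, then with $L=l^\kappa$ there is $m_L>0$ such that $G(I,L,m_L,\xi)$ is satisfied and \[m>m_L>m\bigl(1-L^{-(1-\beta)/\kappa}\bigr)-L^{-(1-\beta)/\kappa}\qquad\text{and}\qquad m_L>L^{\beta-1}.\] -/

import Mathlib

open MeasureTheory Set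

noncomputable section

namespace AlloyMSA

/-- The lattice `ℤ^d`. Mathlib's norm on this type is the supremum norm. -/
abbrev Site (d : ℕ) : Type := Fin d → ℤ

/-- The `ℓ¹`-norm on `ℤ^d`. -/
def norm1 {d : ℕ} (k : Site d) : ℤ := ∑ i, |k i|

/-- The discrete cube `([-l,l]^d + j) ∩ ℤ^d`, for real `l`. -/
def cube {d : ℕ} (l : ℝ) (j : Site d) : Finset (Site d) :=
  Fintype.piFinset fun i => Finset.Icc ⌈(j i : ℝ) - l⌉ ⌊(j i : ℝ) + l⌋

theorem mem_cube {d : ℕ} {l : ℝ} {j k : Site d} :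
    k ∈ cube l j ↔ ∀ i, |(k i : ℝ) - (j i : ℝ)| ≤ l := by
  simp only [cube, Fintype.mem_piFinset, Finset.mem_Icc, Int.ceil_le, Int.le_floor, abs_le]
  refine forall_congr' fun i => ⟨fun h => ⟨by linarith [h.1], by linarith [h.2]⟩,
    fun h => ⟨by linarith [h.1], by linarith [h.2]⟩⟩

/-- The nearest neighbours of `x`, i.e. all `y ∈ ℤ^d` with `‖x - y‖₁ = 1`. -/
def neighbors {d : ℕ} (x : Site d) : Finset (Site d) :=
  (cube 1 x).filter fun y => norm1 (x - y) = 1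

theorem mem_neighbors {d : ℕ} {x y : Site d} : y ∈ neighbors x ↔ norm1 (x - y) = 1 := by
  simp only [neighbors, Finset.mem_filter, and_iff_right_iff_imp]
  intro h
  rw [mem_cube]
  intro i
  have h1 : |(x - y) i| ≤ norm1 (x - y) :=
    Finset.single_le_sum (f := fun i => |(x - y) i|) (fun _ _ => abs_nonneg _) (Finset.mem_univ i)
  rw [h, Pi.sub_apply, abs_sub_comm] at h1
  exact_mod_cast h1

/-- The interior boundary of `S ⊆ ℤ^d`: the points of `S` having fewer than `2d` nearest
neighbours in `S`. -/
def innerBoundary {d : ℕ} (S : Finset (Site d)) : Finset (Site d) :=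
  S.filter fun k => (S.filter fun j => norm1 (k - j) = 1).card < 2 * d

/-- Exponential decay of the single-site potential. -/
def ExpDecay {d : ℕ} (u : Site d → ℝ) : Prop :=
  ∃ C α : ℝ, 0 < C ∧ 0 < α ∧ ∀ k, |u k| ≤ C * Real.exp (-α * (norm1 k : ℝ))

/-- `BV(ℝ)`: integrable functions whose distributional derivative is a finite signed
measure `ν`, which is integrated through its Jordan decomposition. -/
def IsBV (f : ℝ → ℝ) : Prop :=
  Integrable f volume ∧ ∃ ν : SignedMeasure ℝ, ∀ φ : ℝ → ℝ,
    ContDiff ℝ ((⊤ : ℕ∞) : WithTop ℕ∞) φ → HasCompactSupport φ →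
    (∫ x, φ x ∂ν.toJordanDecomposition.posPart) - (∫ x, φ x ∂ν.toJordanDecomposition.negPart)
      = -∫ x, f x * deriv φ x

/-- `ρ` is a density of `μ` with respect to Lebesgue measure. -/
def IsDensity (μ : Measure ℝ) (ρ : ℝ → ℝ) : Prop :=
  (∀ᵐ t ∂(volume : Measure ℝ), 0 ≤ ρ t) ∧ μ = volume.withDensity fun t => ENNReal.ofReal (ρ t)

/-- The configuration space `Ω = ∏_{k ∈ ℤ^d} supp μ`. -/
abbrev Config (d : ℕ) (μ : Measure ℝ) : Type := Site d → μ.support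

/-- `μ` regarded as a measure on its support. -/
def siteMeasure (μ : Measure ℝ) : Measure μ.support := μ.comap Subtype.val

instance (μ : Measure ℝ) [IsProbabilityMeasure μ] : IsProbabilityMeasure (siteMeasure μ) := by
  refine (MeasurableEmbedding.subtype_coe
    Measure.isClosed_support.measurableSet).isProbabilityMeasure_comap ?_
  rw [Subtype.range_coe]
  exact Measure.support_mem_ae

/-- The product measure `ℙ = ⨂_{k ∈ ℤ^d} μ` on `Ω`. -/
def prob (d : ℕ) (μ : Measure ℝ) : Measure (Config d μ) :=
  Measure.infinitePi fun _ => siteMeasure μ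

instance (d : ℕ) (μ : Measure ℝ) [IsProbabilityMeasure μ] : IsProbabilityMeasure (prob d μ) := by
  unfold prob; infer_instance

variable {d : ℕ} {μ : Measure ℝ}

/-- The alloy-type potential `v_ω(x) = ∑_k ω_k u(x - k)`. -/
def potential (u : Site d → ℝ) (ω : Config d μ) (x : Site d) : ℝ :=
  ∑' k, (ω k : ℝ) * u (x - k)

/-- The action of `h_ω = h_0 + v_ω` on functions on `ℤ^d`, with
`(h_0 ψ)(x) = ∑_{‖x-y‖₁ = 1} (ψ(x) - ψ(y))`. -/
def hamiltonian (u : Site d → ℝ) (ω : Config d μ) (ψ : Site d → ℝ) (x : Site d) : ℝ :=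
  (∑ y ∈ neighbors x, (ψ x - ψ y)) + potential u ω x * ψ x

/-- The matrix of the restriction of `h_ω` to `ℓ²(S)`: its entries are `(h_ω δ_y)(x)`,
`x, y ∈ S`. -/
def boxHamiltonian (u : Site d → ℝ) (ω : Config d μ) (S : Finset (Site d)) : Matrix S S ℝ :=
  Matrix.of fun x y => hamiltonian u ω (Pi.single (y : Site d) 1) x

/-- The Green's function `⟨δ_x, (h_ω^S - E)⁻¹ δ_y⟩`, set to zero if `x ∉ S` or `y ∉ S`. -/
def green (u : Site d → ℝ) (ω : Config d μ) (S : Finset (Site d)) (E : ℝ) (x y : Site d) : ℝ :=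
  if h : x ∈ S ∧ y ∈ S then
    (boxHamiltonian u ω S - E • (1 : Matrix S S ℝ))⁻¹ ⟨x, h.1⟩ ⟨y, h.2⟩
  else 0

/-- The cube of radius `l` about `x` is `(m,E)`-regular for `ω`. -/
def IsRegular (u : Site d → ℝ) (l : ℝ) (x : Site d) (m E : ℝ) (ω : Config d μ) : Prop :=
  E ∉ spectrum ℝ (boxHamiltonian u ω (cube l x)) ∧
    ∀ w ∈ innerBoundary (cube l x), |green u ω (cube l x) E x w| ≤ Real.exp (-(m * l))

/-- The cube of radius `l` about `x` is uniformly `(m,E)`-regular for `ω`: it is `(m,E)`-regular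
for all configurations that agree with `ω` on the cube of radius `4l` about `x`. -/
def IsUnifRegular (u : Site d → ℝ) (l : ℝ) (x : Site d) (m E : ℝ) (ω : Config d μ) : Prop :=
  ∀ ω' : Config d μ, (∀ k ∈ cube (4 * l) x, ω' k = ω k) → IsRegular u l x m E ω'

/-- The event that for some `E ∈ I` neither of the cubes of radius `l` about `z₁` and `z₂` is
uniformly `(m,E)`-regular. -/
def badEvent (μ : Measure ℝ) (u : Site d → ℝ) (l : ℝ) (z₁ z₂ : Site d) (m : ℝ) (I : Set ℝ) :
    Set (Config d μ) :=
  {ω | ∃ E ∈ I, ¬ IsUnifRegular u l z₁ m E ω ∧ ¬ IsUnifRegular u l z₂ m E ω}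

/-- The estimate `G(I,l,m,ξ)`. -/
def GEstimate (μ : Measure ℝ) (u : Site d → ℝ) (I : Set ℝ) (l m ξ : ℝ) : Prop :=
  ∀ z₁ z₂ : Site d, 8 * l < ‖z₁ - z₂‖ →
    1 - l ^ (-(2 * ξ)) ≤ (prob d μ).real (badEvent μ u l z₁ z₂ m I)ᶜ

end AlloyMSA

end

/-!
The induction step of multiscale analysis for an alloy-type potential without sign condition.

The single-site potential `u` decays exponentially, so some moment of it under an injective linear
form `ℓ` on `ℤ^d` does not vanish. For the smallest such order `n` the convolution of `ℓ ^ n` with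
`u` is a nonzero constant: moving the couplings along a multiple of `ℓ ^ n`, cut off to a cube of
radius `4L`, raises the potential on the concentric cube of radius `L`, and with it every eigenvalue
there, at a definite rate and at a cost polynomial in `L`. Since a BV density is Lipschitz in `L¹`
under translations, a common resonance of width `ε` of two distant cubes, uniform in the far
couplings, has probability at most a power of `L` times `√ε`.

Disjoint pairs of distant bad cubes of radius `l` are independent, so four of them occur in a cube
of radius `L = l ^ κ` with probability of order `L ^ (4d) l ^ (-4ξ) ≪ L ^ (-2ξ)`. Otherwise the bad
cubes are covered by three balls of radius `8l`, and if moreover the concentric cubes around the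
center are non-resonant of width `exp (-l ^ (β / 2))`, then the geometric resolvent identity can be
iterated about `L / l` times through regular cubes, each step gaining a factor `exp (-m * l)` up to
errors absorbed in the new mass `m_L`.
-/

/-! ### Translates of a measure with a density of bounded variation -/

namespace AlloyMSA

section Translation

open scoped ContDiff ENNReal NNReal

theorem IsDensity.integral_eq {μ : Measure ℝ} {ρ : ℝ → ℝ} (hρ : IsDensity μ ρ)
    (hm : AEMeasurable ρ) (φ : ℝ → ℝ) : ∫ t, φ t ∂μ = ∫ t, ρ t * φ t := by
  rw [hρ.2, integral_withDensity_eq_integral_toReal_smul₀ hm.ennreal_ofReal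
    (.of_forall fun _ => ENNReal.ofReal_lt_top)]
  refine integral_congr_ae ?_
  filter_upwards [hρ.1] with t ht
  rw [ENNReal.toReal_ofReal ht, smul_eq_mul]

section MovingWindow

variable {E : Type*} [NormedAddCommGroup E] [NormedSpace ℝ E] {φ : ℝ → E}

theorem hasCompactSupport_integral_moving_window (hφ : HasCompactSupport φ) (s : ℝ) :
    HasCompactSupport fun t => ∫ r in t..t + s, φ r := by
  refine .intro (hφ.isCompact.add (isCompact_closedBall (0 : ℝ) |s|)) fun t ht => ?_
  have hzero : EqOn φ 0 (uIcc t (t + s)) := fun r hr => by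
    by_contra hne
    refine ht ⟨r, subset_tsupport φ hne, t - r, ?_, add_sub_cancel r t⟩
    simpa [abs_sub_comm] using abs_sub_left_of_mem_uIcc hr
  simp [intervalIntegral.integral_congr hzero]

variable [CompleteSpace E]

theorem hasDerivAt_integral_moving_window (hφ : Continuous φ) (s t : ℝ) :
    HasDerivAt (fun t => ∫ r in t..t + s, φ r) (φ (t + s) - φ t) t := by
  have hprim (t : ℝ) : HasDerivAt (fun t => ∫ r in 0..t, φ r) (φ t) t :=
    intervalIntegral.integral_hasDerivAt_right (hφ.intervalIntegrable _ _)
      (hφ.stronglyMeasurableAtFilter _ _) hφ.continuousAt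
  refine (((hprim (t + s)).comp_add_const t s).sub (hprim t)).congr_of_eventuallyEq
    (.of_forall fun t => ?_)
  exact (intervalIntegral.integral_interval_sub_left (hφ.intervalIntegrable _ _)
    (hφ.intervalIntegrable _ _)).symm

theorem contDiff_integral_moving_window (hφ : ContDiff ℝ ∞ φ) (s : ℝ) :
    ContDiff ℝ ∞ fun t => ∫ r in t..t + s, φ r := by
  have hderiv := hasDerivAt_integral_moving_window hφ.continuous s
  refine contDiff_infty_iff_deriv.2 ⟨fun t => (hderiv t).differentiableAt, ?_⟩
  rw [funext fun t => (hderiv t).deriv]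
  exact (hφ.comp (contDiff_id.add contDiff_const)).sub hφ

end MovingWindow

theorem abs_integral_le_mul_measureReal_univ {α : Type*} [MeasurableSpace α] (μ : Measure α)
    [IsFiniteMeasure μ] {ψ : α → ℝ} {C : ℝ} (hψ : ∀ t, |ψ t| ≤ C) :
    |∫ t, ψ t ∂μ| ≤ C * μ.real univ :=
  norm_integral_le_of_norm_le_const (f := ψ) (.of_forall hψ)

-- `φ(· + s) - φ` is the derivative of the moving integral `t ↦ ∫ r in t..t + s, φ r`, a test
-- function bounded by `|s|`.
theorem IsBV.exists_abs_integral_translate_sub_le {f : ℝ → ℝ} (hf : IsBV f) :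
    ∃ V : ℝ≥0, ∀ (s : ℝ) (φ : ℝ → ℝ), ContDiff ℝ ∞ φ → HasCompactSupport φ → (∀ t, |φ t| ≤ 1) →
      |(∫ t, f t * φ (t + s)) - ∫ t, f t * φ t| ≤ V * |s| := by
  obtain ⟨hint, ν, hν⟩ := hf
  set p := ν.toJordanDecomposition.posPart
  set q := ν.toJordanDecomposition.negPart
  refine ⟨⟨p.real univ + q.real univ, by positivity⟩, fun s φ hφ hφc hφ1 => ?_⟩
  set ψ : ℝ → ℝ := fun t => ∫ r in t..t + s, φ r
  have hψ1 (t : ℝ) : |ψ t| ≤ |s| := by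
    simpa using intervalIntegral.norm_integral_le_of_norm_le_const (a := t) (b := t + s)
      (f := φ) (C := 1) fun r _ => hφ1 r
  have hintegrable (s : ℝ) : Integrable fun t => f t * φ (t + s) := by
    have hcont : Continuous fun t => φ (t + s) := hφ.continuous.comp (continuous_add_const s)
    simpa only [mul_comm] using
      hint.bdd_mul (c := 1) hcont.aestronglyMeasurable (.of_forall fun t => hφ1 (t + s))
  have hderiv : ∫ t, f t * deriv ψ t = (∫ t, f t * φ (t + s)) - ∫ t, f t * φ t := by
    rw [← integral_sub (hintegrable s) (by simpa using hintegrable 0)]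
    simp only [ψ, (hasDerivAt_integral_moving_window hφ.continuous s _).deriv, mul_sub]
  have htest := hν ψ (contDiff_integral_moving_window hφ s)
    (hasCompactSupport_integral_moving_window hφc s)
  rw [← hderiv, ← neg_neg (∫ t, f t * deriv ψ t), ← htest, abs_neg]
  calc |(∫ t, ψ t ∂p) - ∫ t, ψ t ∂q| ≤ |∫ t, ψ t ∂p| + |∫ t, ψ t ∂q| := abs_sub _ _
    _ ≤ |s| * p.real univ + |s| * q.real univ := by
        gcongr <;> exact abs_integral_le_mul_measureReal_univ _ hψ1
    _ = (p.real univ + q.real univ) * |s| := by ring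

section SmoothTestFunctions

variable {E : Type*} [NormedAddCommGroup E] [NormedSpace ℝ E] [FiniteDimensional ℝ E]

theorem exists_contDiff_one_on_isCompact_zero_off_isOpen {K U : Set E} (hK : IsCompact K)
    (hU : IsOpen U) (hKU : K ⊆ U) :
    ∃ φ : E → ℝ, ContDiff ℝ ∞ φ ∧ HasCompactSupport φ ∧ (∀ t, φ t ∈ Icc 0 1) ∧
      (∀ t ∈ K, φ t = 1) ∧ ∀ t ∉ U, φ t = 0 := by
  obtain ⟨R, hR⟩ := hK.isBounded.subset_ball 0
  obtain ⟨φ, hφ0, hφ1, hφ⟩ := exists_contMDiffMap_zero_one_of_isClosed (n := ⊤)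
    (modelWithCornersSelf ℝ E) (hU.inter Metric.isOpen_ball).isClosed_compl hK.isClosed
    (disjoint_left.2 fun _ ht htK => ht ⟨hKU htK, hR htK⟩)
  refine ⟨φ, φ.contMDiff.contDiff, ?_, hφ, fun t ht => hφ1 ht, fun t ht => hφ0 fun h => ht h.1⟩
  exact .intro (isCompact_closedBall 0 R) fun t ht =>
    hφ0 fun h => ht (Metric.ball_subset_closedBall h.2)

variable [MeasurableSpace E] [BorelSpace E] {μ ν : Measure E} [IsFiniteMeasure μ]
  [IsFiniteMeasure ν] {c : ℝ≥0}

theorem measure_isCompact_le_measure_isOpen_add {K U : Set E} (hK : IsCompact K) (hU : IsOpen U)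
    (hKU : K ⊆ U)
    (h : ∀ φ : E → ℝ, ContDiff ℝ ∞ φ → HasCompactSupport φ → (∀ t, φ t ∈ Icc 0 1) →
      ∫ t, φ t ∂μ ≤ (∫ t, φ t ∂ν) + c) :
    μ K ≤ ν U + c := by
  obtain ⟨φ, hφ, hφc, hφ01, hφK, hφU⟩ :=
    exists_contDiff_one_on_isCompact_zero_off_isOpen hK hU hKU
  have hint (m : Measure E) [IsFiniteMeasure m] : Integrable φ m :=
    hφ.continuous.integrable_of_hasCompactSupport hφc
  have hK' : μ.real K ≤ ∫ t, φ t ∂μ := by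
    rw [← integral_indicator_one hK.measurableSet]
    exact integral_mono ((integrable_const 1).indicator hK.measurableSet) (hint μ)
      (indicator_le' (fun t ht => (hφK t ht).ge) fun t _ => (hφ01 t).1)
  have hU' : ∫ t, φ t ∂ν ≤ ν.real U := by
    rw [← integral_indicator_one hU.measurableSet]
    exact integral_mono (hint ν) ((integrable_const 1).indicator hU.measurableSet)
      (le_indicator (fun t _ => (hφ01 t).2) fun t ht => (hφU t ht).le)
  have hreal : μ.real K ≤ ν.real U + c := by linarith [h φ hφ hφc hφ01]
  rw [← ofReal_measureReal (μ := μ), ← ofReal_measureReal (μ := ν),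
    ← ENNReal.ofReal_coe_nnreal, ← ENNReal.ofReal_add measureReal_nonneg c.coe_nonneg]
  exact ENNReal.ofReal_le_ofReal hreal

theorem measure_le_add_of_integral_contDiff_le
    (h : ∀ φ : E → ℝ, ContDiff ℝ ∞ φ → HasCompactSupport φ → (∀ t, φ t ∈ Icc 0 1) →
      ∫ t, φ t ∂μ ≤ (∫ t, φ t ∂ν) + c) {B : Set E} (hB : MeasurableSet B) :
    μ B ≤ ν B + c := by
  have : ProperSpace E := FiniteDimensional.proper ℝ E
  rw [hB.measure_eq_iSup_isCompact_of_ne_top (measure_ne_top μ B)]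
  refine iSup₂_le fun K hKB => iSup_le fun hK => ?_
  rw [B.measure_eq_iInf_isOpen ν, ENNReal.iInf_add]
  refine le_iInf fun U => ?_
  rw [ENNReal.iInf_add]
  refine le_iInf fun hBU => ?_
  rw [ENNReal.iInf_add]
  exact le_iInf fun hU => measure_isCompact_le_measure_isOpen_add hK hU (hKB.trans hBU) h

end SmoothTestFunctions

/-- Translating `μ` by `s` changes the measure of a set by at most `V ‖s‖`. For measures on `ℝ`
with density `ρ` this is the form in which `ρ ∈ BV` is used. -/
def IsTranslationLipschitz {G : Type*} [SeminormedAddCommGroup G] [MeasurableSpace G]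
    (μ : Measure G) (V : ℝ≥0) : Prop :=
  ∀ (s : G) (B : Set G), MeasurableSet B → μ B ≤ μ ((· + s) ⁻¹' B) + V * ‖s‖ₑ

theorem exists_isTranslationLipschitz {μ : Measure ℝ} [IsFiniteMeasure μ] {ρ : ℝ → ℝ}
    (hρ : IsDensity μ ρ) (hBV : IsBV ρ) : ∃ V : ℝ≥0, IsTranslationLipschitz μ V := by
  obtain ⟨V, hV⟩ := hBV.exists_abs_integral_translate_sub_le
  have hρm : AEMeasurable ρ := hBV.1.1.aemeasurable
  refine ⟨V, fun s B hB => ?_⟩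
  have hshift : Measurable fun t : ℝ => t + s := measurable_add_const s
  rw [← Measure.map_apply hshift hB, enorm_eq_nnnorm, ← ENNReal.coe_mul]
  refine measure_le_add_of_integral_contDiff_le (fun φ hφ hφc hφ01 => ?_) hB
  rw [integral_map hshift.aemeasurable hφ.continuous.aestronglyMeasurable,
    hρ.integral_eq hρm, hρ.integral_eq hρm]
  have hφ1 (t : ℝ) : |φ t| ≤ 1 := by
    rw [abs_of_nonneg (hφ01 t).1]
    exact (hφ01 t).2
  have hle := neg_le_of_abs_le (hV s φ hφ hφc hφ1)
  push_cast
  rw [Real.norm_eq_abs]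
  linarith

namespace IsTranslationLipschitz

variable {G : Type*} [SeminormedAddCommGroup G] [MeasurableSpace G] [MeasurableAdd₂ G]
  {μ : Measure G} [IsProbabilityMeasure μ] {V : ℝ≥0} {ι : Type*} [Fintype ι]

theorem measure_pi_le_single [DecidableEq ι] (h : IsTranslationLipschitz μ V) (i : ι) (s : G)
    {B : Set (ι → G)} (hB : MeasurableSet B) :
    Measure.pi (fun _ => μ) B ≤
      Measure.pi (fun _ => μ) ((· + Pi.single i s) ⁻¹' B) + V * ‖s‖ₑ := by
  set c : ℝ≥0∞ := V * ‖s‖ₑ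
  set B' : Set (ι → G) := (· + Pi.single i s) ⁻¹' B
  have hB' : MeasurableSet B' := measurable_add_const _ hB
  have hone {D : Set (ι → G)} (hD : MeasurableSet D) :
      Measurable (D.indicator (1 : (ι → G) → ℝ≥0∞)) := measurable_one.indicator hD
  have hfiber (x : ι → G) : ∫⁻ t, B.indicator 1 (Function.update x i t) ∂μ ≤
      ∫⁻ t, (B'.indicator 1 (Function.update x i t) + c) ∂μ := by
    have hupd : Measurable (Function.update x i) := measurable_update x
    have hshift : Function.update x i ⁻¹' B' = (· + s) ⁻¹' (Function.update x i ⁻¹' B) := by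
      ext t
      have : Function.update x i t + Pi.single i s = Function.update x i (t + s) := by
        ext j
        rcases eq_or_ne j i with rfl | hj <;> simp [*]
      simp only [B', mem_preimage, this]
    calc ∫⁻ t, B.indicator 1 (Function.update x i t) ∂μ
        = μ (Function.update x i ⁻¹' B) := lintegral_indicator_one (hupd hB)
      _ ≤ μ (Function.update x i ⁻¹' B') + c := hshift ▸ h s _ (hupd hB)
      _ = (∫⁻ t, B'.indicator 1 (Function.update x i t) ∂μ) + c := by
          rw [← lintegral_indicator_one (hupd hB')]; rfl
      _ = ∫⁻ t, (B'.indicator 1 (Function.update x i t) + c) ∂μ := by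
          rw [lintegral_add_right _ measurable_const, lintegral_const, measure_univ, mul_one]
  calc Measure.pi (fun _ => μ) B
      = (∫⋯∫⁻_Finset.univ, B.indicator 1 ∂fun _ => μ) 0 := by
        rw [lmarginal_univ, lintegral_indicator_one hB]
    _ ≤ (∫⋯∫⁻_Finset.univ, (fun x => B'.indicator 1 x + c) ∂fun _ => μ) 0 := by
        rw [lmarginal_erase' _ (hone hB) (Finset.mem_univ i),
          lmarginal_erase' _ ((hone hB').add_const c) (Finset.mem_univ i)]
        exact lmarginal_mono hfiber 0
    _ = Measure.pi (fun _ => μ) B' + c := by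
        rw [lmarginal_univ, lintegral_add_right _ measurable_const, lintegral_const, measure_univ,
          mul_one, lintegral_indicator_one hB']

theorem measure_pi_le (h : IsTranslationLipschitz μ V) (a : ι → G)
    {B : Set (ι → G)} (hB : MeasurableSet B) :
    Measure.pi (fun _ => μ) B ≤
      Measure.pi (fun _ => μ) ((· + a) ⁻¹' B) + V * ∑ i, ‖a i‖ₑ := by
  classical
  suffices ∀ s : Finset ι, Measure.pi (fun _ => μ) B ≤
      Measure.pi (fun _ => μ) ((· + ∑ i ∈ s, Pi.single i (a i)) ⁻¹' B) +
        V * ∑ i ∈ s, ‖a i‖ₑ by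
    simpa only [Finset.univ_sum_single] using this Finset.univ
  intro s
  induction s using Finset.induction_on with
  | empty => simp
  | insert i s hi ih =>
    have hshift : (· + Pi.single i (a i)) ⁻¹' ((· + ∑ j ∈ s, Pi.single j (a j)) ⁻¹' B) =
        (· + ∑ j ∈ insert i s, Pi.single j (a j)) ⁻¹' B := by
      ext x
      simp only [mem_preimage, Finset.sum_insert hi, add_assoc]
    calc Measure.pi (fun _ => μ) B
        ≤ Measure.pi (fun _ => μ) ((· + ∑ j ∈ s, Pi.single j (a j)) ⁻¹' B) +
            V * ∑ j ∈ s, ‖a j‖ₑ := ih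
      _ ≤ (Measure.pi (fun _ => μ) ((· + ∑ j ∈ insert i s, Pi.single j (a j)) ⁻¹' B) +
            V * ‖a i‖ₑ) + V * ∑ j ∈ s, ‖a j‖ₑ := by
          gcongr
          exact hshift ▸ h.measure_pi_le_single i (a i) (measurable_add_const _ hB)
      _ = _ := by rw [Finset.sum_insert (f := fun j => ‖a j‖ₑ) hi, mul_add, add_assoc]

theorem measureReal_pi_le_nsmul (h : IsTranslationLipschitz μ V) (a : ι → G)
    {B : Set (ι → G)} (hB : MeasurableSet B) (j : ℕ) :
    (Measure.pi fun _ => μ).real B ≤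
      (Measure.pi fun _ => μ).real ((· + j • a) ⁻¹' B) + V * (j * ∑ i, ‖a i‖) := by
  have hfin : V * ∑ i, ‖(j • a) i‖ₑ ≠ ⊤ :=
    ENNReal.mul_ne_top ENNReal.coe_ne_top (ENNReal.sum_ne_top.2 fun i _ => enorm_ne_top)
  have hle := ENNReal.toReal_mono (by finiteness) (h.measure_pi_le (j • a) hB)
  rw [ENNReal.toReal_add (by finiteness) hfin, ENNReal.toReal_mul,
    ENNReal.toReal_sum fun i _ => enorm_ne_top] at hle
  simp only [toReal_enorm, ENNReal.coe_toReal] at hle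
  refine hle.trans (add_le_add_right (mul_le_mul_of_nonneg_left ?_ V.2) _)
  rw [Finset.mul_sum]
  exact Finset.sum_le_sum fun i _ => norm_nsmul_le

open Classical in
-- The translation bound is averaged over the first `J` multiples of `a`.
theorem measureReal_pi_le_of_card_le (h : IsTranslationLipschitz μ V) (a : ι → G)
    {A : Set (ι → G)} (hA : MeasurableSet A) {J : ℕ} (hJ : 0 < J) {N : ℕ}
    (hN : ∀ η, ((Finset.range J).filter fun j => η + j • a ∈ A).card ≤ N) :
    (Measure.pi fun _ => μ).real A ≤ N / J + V * (J * ∑ i, ‖a i‖) := by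
  set P : Measure (ι → G) := Measure.pi fun _ => μ
  have hA' (j : ℕ) : MeasurableSet ((· + j • a) ⁻¹' A) := measurable_add_const _ hA
  have hind (j : ℕ) : Integrable (((· + j • a) ⁻¹' A).indicator (1 : (ι → G) → ℝ)) P :=
    (integrable_const 1).indicator (hA' j)
  have hshift (j : ℕ) (hj : j ∈ Finset.range J) :
      P.real A ≤ P.real ((· + j • a) ⁻¹' A) + V * (J * ∑ i, ‖a i‖) := by
    refine (h.measureReal_pi_le_nsmul a hA j).trans ?_
    gcongr
    exact (Finset.mem_range.1 hj).le
  have hsum : ∑ j ∈ Finset.range J, P.real ((· + j • a) ⁻¹' A) ≤ N :=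
    calc ∑ j ∈ Finset.range J, P.real ((· + j • a) ⁻¹' A)
        = ∫ η, ∑ j ∈ Finset.range J, ((· + j • a) ⁻¹' A).indicator 1 η ∂P := by
          rw [integral_finsetSum _ fun j _ => hind j]
          simp_rw [integral_indicator_one (hA' _)]
      _ ≤ ∫ _, (N : ℝ) ∂P := by
          refine integral_mono (integrable_finsetSum _ fun j _ => hind j) (integrable_const _)
            fun η => ?_
          simp only [indicator_apply, Pi.one_apply, Finset.sum_boole, mem_preimage]
          exact_mod_cast hN η
      _ = N := by simp
  have htotal := Finset.sum_le_sum hshift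
  rw [Finset.sum_add_distrib] at htotal
  simp only [Finset.sum_const, Finset.card_range, nsmul_eq_mul] at htotal
  rw [← sub_le_iff_le_add, le_div_iff₀ (by exact_mod_cast hJ)]
  linarith

end IsTranslationLipschitz

end Translation

end AlloyMSA

/-! ### Resonances of symmetric operators -/

namespace AlloyMSA

section Resonant

variable {F : Type*} [NormedAddCommGroup F] [NormedSpace ℝ F]

/-- The energy `E` is `ε`-resonant for `T`: it is an approximate eigenvalue of `T`, up to the
relative error `ε`. For symmetric `T` on a finite-dimensional space this says that `E` has distance
at most `ε` from the spectrum. -/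
def Resonant (T : F →ₗ[ℝ] F) (E ε : ℝ) : Prop :=
  ∃ φ : F, φ ≠ 0 ∧ ‖T φ - E • φ‖ ≤ ε * ‖φ‖

theorem Resonant.perturb {T T' : F →ₗ[ℝ] F} {E E' ε δ : ℝ} (h : Resonant T E ε)
    (hδ : ∀ φ, ‖(T' φ - E' • φ) - (T φ - E • φ)‖ ≤ δ * ‖φ‖) : Resonant T' E' (ε + δ) := by
  obtain ⟨φ, hφ, hE⟩ := h
  refine ⟨φ, hφ, ?_⟩
  rw [add_mul]
  exact (norm_le_norm_add_norm_sub' _ _).trans (add_le_add hE (hδ φ))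

theorem Resonant.change_energy {T : F →ₗ[ℝ] F} {E E' ε δ : ℝ} (h : Resonant T E ε)
    (hE : |E - E'| ≤ δ) : Resonant T E' (ε + δ) :=
  h.perturb fun φ => by
    rw [sub_sub_sub_cancel_left, ← sub_smul, norm_smul, Real.norm_eq_abs]
    gcongr

theorem resonant_iff_exists_norm_eq_one {T : F →ₗ[ℝ] F} {E ε : ℝ} :
    Resonant T E ε ↔ ∃ φ : F, ‖φ‖ = 1 ∧ ‖T φ - E • φ‖ ≤ ε := by
  constructor
  · rintro ⟨φ, hφ, hE⟩
    have hpos : 0 < ‖φ‖ := norm_pos_iff.2 hφ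
    refine ⟨‖φ‖⁻¹ • φ, norm_smul_inv_norm hφ, ?_⟩
    rw [map_smul, smul_comm, ← smul_sub, norm_smul, norm_inv, norm_norm,
      inv_mul_le_iff₀ hpos, mul_comm]
    exact hE
  · rintro ⟨φ, hφ, hE⟩
    exact ⟨φ, norm_ne_zero_iff.1 (hφ ▸ one_ne_zero), by rwa [hφ, mul_one]⟩

theorem norm_le_of_not_resonant {T : F →ₗ[ℝ] F} {E ε : ℝ} (hε : 0 < ε) (h : ¬ Resonant T E ε)
    (φ : F) : ‖φ‖ ≤ ‖T φ - E • φ‖ / ε := by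
  rw [le_div_iff₀' hε]
  by_contra! hlt
  refine h ⟨φ, ?_, hlt.le⟩
  rintro rfl
  simp at hlt

end Resonant

section Measurability

theorem measurableSet_of_isSigmaCompact {X : Type*} [TopologicalSpace X] [T2Space X]
    [MeasurableSpace X] [OpensMeasurableSpace X] {s : Set X} (h : IsSigmaCompact s) :
    MeasurableSet s := by
  obtain ⟨K, hK, rfl⟩ := h
  exact MeasurableSet.iUnion fun n => (hK n).measurableSet

theorem isSigmaCompact_of_isClosed {X : Type*} [TopologicalSpace X] [SigmaCompactSpace X]
    {s : Set X} (h : IsClosed s) : IsSigmaCompact s :=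
  isSigmaCompact_univ.of_isClosed_subset h (subset_univ s)

variable {X F₁ F₂ : Type*} [TopologicalSpace X] [T2Space X] [SigmaCompactSpace X]
  [MeasurableSpace X] [OpensMeasurableSpace X]
  [NormedAddCommGroup F₁] [NormedSpace ℝ F₁] [FiniteDimensional ℝ F₁]
  [NormedAddCommGroup F₂] [NormedSpace ℝ F₂] [FiniteDimensional ℝ F₂]

-- The set is the projection of a closed set of tuples (parameter, energy, two unit vectors).
theorem measurableSet_common_resonance {T₁ : X → F₁ →ₗ[ℝ] F₁} {T₂ : X → F₂ →ₗ[ℝ] F₂}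
    (h₁ : Continuous fun p : X × F₁ => T₁ p.1 p.2) (h₂ : Continuous fun p : X × F₂ => T₂ p.1 p.2)
    (ε : ℝ) : MeasurableSet {η | ∃ E, Resonant (T₁ η) E ε ∧ Resonant (T₂ η) E ε} := by
  have := FiniteDimensional.proper_real F₁
  have := FiniteDimensional.proper_real F₂
  let Z : Set (X × ℝ × F₁ × F₂) := {p |
    (‖p.2.2.1‖ = 1 ∧ ‖T₁ p.1 p.2.2.1 - p.2.1 • p.2.2.1‖ ≤ ε) ∧
    (‖p.2.2.2‖ = 1 ∧ ‖T₂ p.1 p.2.2.2 - p.2.1 • p.2.2.2‖ ≤ ε)}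
  have _hT₁ : Continuous fun p : X × ℝ × F₁ × F₂ => T₁ p.1 p.2.2.1 :=
    h₁.comp (by fun_prop : Continuous fun p : X × ℝ × F₁ × F₂ => (p.1, p.2.2.1))
  have _hT₂ : Continuous fun p : X × ℝ × F₁ × F₂ => T₂ p.1 p.2.2.2 :=
    h₂.comp (by fun_prop : Continuous fun p : X × ℝ × F₁ × F₂ => (p.1, p.2.2.2))
  have hZ : IsClosed Z :=
    ((isClosed_eq (by fun_prop) continuous_const).and
      (isClosed_le (by fun_prop) continuous_const)).and
    ((isClosed_eq (by fun_prop) continuous_const).and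
      (isClosed_le (by fun_prop) continuous_const))
  have hproj : {η | ∃ E, Resonant (T₁ η) E ε ∧ Resonant (T₂ η) E ε} = Prod.fst '' Z := by
    ext η
    simp only [resonant_iff_exists_norm_eq_one, mem_ofPred_eq, mem_image, Prod.exists, Z]
    constructor
    · rintro ⟨E, ⟨φ, hφ⟩, ψ, hψ⟩
      exact ⟨η, E, φ, ψ, ⟨hφ, hψ⟩, rfl⟩
    · rintro ⟨_, E, φ, ψ, ⟨hφ, hψ⟩, rfl⟩
      exact ⟨E, ⟨φ, hφ⟩, ψ, hψ⟩
  rw [hproj]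
  exact measurableSet_of_isSigmaCompact ((isSigmaCompact_of_isClosed hZ).image continuous_fst)

end Measurability

section Symmetric

variable {F : Type*} [NormedAddCommGroup F] [InnerProductSpace ℝ F]

/-- There is a `k`-dimensional subspace on which the quadratic form of `T` is at most `t`. By the
min-max principle, for symmetric `T` the largest such `k` counts the eigenvalues up to `t`. -/
def HasSubspaceBelow (T : F →ₗ[ℝ] F) (t : ℝ) (k : ℕ) : Prop :=
  ∃ V : Submodule ℝ F, Module.finrank ℝ V = k ∧ ∀ ψ ∈ V, inner ℝ ψ (T ψ) ≤ t * ‖ψ‖ ^ 2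

theorem hasSubspaceBelow_zero (T : F →ₗ[ℝ] F) (t : ℝ) : HasSubspaceBelow T t 0 :=
  ⟨⊥, finrank_bot ℝ F, fun ψ hψ => by simp [(Submodule.mem_bot ℝ).1 hψ]⟩

theorem HasSubspaceBelow.mono_form {T T' : F →ₗ[ℝ] F} {c : ℝ}
    (hle : ∀ ψ, inner ℝ ψ (T ψ) + c * ‖ψ‖ ^ 2 ≤ inner ℝ ψ (T' ψ)) {t : ℝ} {k : ℕ}
    (h : HasSubspaceBelow T' t k) : HasSubspaceBelow T (t - c) k := by
  obtain ⟨V, hk, hV⟩ := h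
  exact ⟨V, hk, fun ψ hψ => by linarith [hV ψ hψ, hle ψ]⟩

theorem HasSubspaceBelow.mono_level {T : F →ₗ[ℝ] F} {t t' : ℝ} (ht : t ≤ t') {k : ℕ}
    (h : HasSubspaceBelow T t k) : HasSubspaceBelow T t' k := by
  obtain ⟨V, hk, hV⟩ := h
  exact ⟨V, hk, fun ψ hψ => (hV ψ hψ).trans (by gcongr)⟩

variable [FiniteDimensional ℝ F]

theorem HasSubspaceBelow.le_finrank {T : F →ₗ[ℝ] F} {t : ℝ} {k : ℕ}
    (h : HasSubspaceBelow T t k) : k ≤ Module.finrank ℝ F := by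
  obtain ⟨V, rfl, -⟩ := h
  exact Submodule.finrank_le V

theorem Resonant.exists_eigenvalue {T : F →ₗ[ℝ] F} (hT : T.IsSymmetric) {n : ℕ}
    (hn : Module.finrank ℝ F = n) {E ε : ℝ} (h : Resonant T E ε) (hε : 0 ≤ ε) :
    ∃ i, |hT.eigenvalues hn i - E| ≤ ε := by
  obtain ⟨φ, hφ, hE⟩ := h
  by_contra! hfar
  set b := hT.eigenvectorBasis hn
  have hcoord (i : Fin n) :
      inner ℝ (b i) (T φ - E • φ) = (hT.eigenvalues hn i - E) * inner ℝ (b i) φ := by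
    rw [inner_sub_right, ← hT, hT.apply_eigenvectorBasis, inner_smul_left, inner_smul_right,
      sub_mul]
    rfl
  have hsq (i : Fin n) : ε ^ 2 < (hT.eigenvalues hn i - E) ^ 2 :=
    sq_lt_sq.2 ((abs_of_nonneg hε).trans_lt (hfar i))
  obtain ⟨i, hi⟩ : ∃ i, inner ℝ (b i) φ ≠ 0 := by
    by_contra! hzero
    exact hφ (by rw [← b.sum_repr' φ]; simp [hzero])
  have hlt : (ε * ‖φ‖) ^ 2 < ‖T φ - E • φ‖ ^ 2 := by
    rw [mul_pow, ← b.sum_sq_inner_right, ← b.sum_sq_inner_right, Finset.mul_sum]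
    simp_rw [hcoord, mul_pow]
    refine Finset.sum_lt_sum (fun j _ => ?_) ⟨i, Finset.mem_univ i, ?_⟩
    · exact mul_le_mul_of_nonneg_right (hsq j).le (sq_nonneg _)
    · exact mul_lt_mul_of_pos_right (hsq i) (by positivity)
  exact absurd hE (not_le.2 (lt_of_pow_lt_pow_left₀ 2 (norm_nonneg _) hlt))

-- Adjoining the eigenvector `e` with eigenvalue `t ≤ s` keeps the quadratic form below `s`,
-- because `T - t` is nonpositive on `V` and vanishes on `e`.
theorem HasSubspaceBelow.succ_of_eigenvector {T : F →ₗ[ℝ] F} (hT : T.IsSymmetric) {r t s : ℝ}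
    {e : F} (he0 : e ≠ 0) (he : T e = t • e) (hrt : r < t) (hts : t ≤ s) {k : ℕ}
    (h : HasSubspaceBelow T r k) : HasSubspaceBelow T s (k + 1) := by
  obtain ⟨V, rfl, hV⟩ := h
  have heV : e ∉ V := fun hmem => by
    have hle := hV e hmem
    rw [he, inner_smul_right, real_inner_self_eq_norm_sq] at hle
    exact absurd hle (not_le.2 (mul_lt_mul_of_pos_right hrt (by positivity)))
  refine ⟨V ⊔ Submodule.span ℝ {e}, Submodule.finrank_sup_span_singleton heV, fun ψ hψ => ?_⟩
  obtain ⟨v, hv, w, hw, rfl⟩ := Submodule.mem_sup.1 hψ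
  obtain ⟨c, rfl⟩ := Submodule.mem_span_singleton.1 hw
  have hsplit : inner ℝ (v + c • e) (T (v + c • e)) =
      inner ℝ v (T v) - t * ‖v‖ ^ 2 + t * ‖v + c • e‖ ^ 2 := by
    have hev : inner ℝ e (T v) = t * inner ℝ e v := by
      rw [← hT, he, real_inner_smul_left]
    simp only [← real_inner_self_eq_norm_sq, map_add, map_smul, he, inner_add_left,
      inner_add_right, real_inner_smul_left, real_inner_smul_right, hev, real_inner_comm e v]
    ring
  rw [hsplit]
  nlinarith [hV v hv, sq_nonneg ‖v‖, sq_nonneg ‖v + c • e‖]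

theorem HasSubspaceBelow.succ_of_resonant {T T' : F →ₗ[ℝ] F} (hT : T.IsSymmetric) {E ε : ℝ}
    (hε : 0 < ε) (hle : ∀ ψ, inner ℝ ψ (T ψ) + 3 * ε * ‖ψ‖ ^ 2 ≤ inner ℝ ψ (T' ψ))
    (hr : Resonant T E ε) {k : ℕ} (h : HasSubspaceBelow T' (E + ε) k) :
    HasSubspaceBelow T (E + ε) (k + 1) := by
  obtain ⟨i, hi⟩ := hr.exists_eigenvalue hT rfl hε.le
  have hi := abs_le.1 hi
  refine (h.mono_form hle).succ_of_eigenvector hT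
    ((hT.eigenvectorBasis rfl).toBasis.ne_zero i) ?_ (t := hT.eigenvalues rfl i) ?_ ?_
  · simp
  · linarith
  · linarith

open Classical in
-- Each resonance forces an eigenvalue to cross the level `E + ε`.
theorem card_resonant_le (T : ℕ → F →ₗ[ℝ] F) (hT : ∀ j, (T j).IsSymmetric) {E ε : ℝ}
    (hε : 0 < ε)
    (hle : ∀ j ψ, inner ℝ ψ (T j ψ) + 3 * ε * ‖ψ‖ ^ 2 ≤ inner ℝ ψ (T (j + 1) ψ)) (J : ℕ) :
    ((Finset.range J).filter fun j => Resonant (T j) E ε).card ≤ Module.finrank ℝ F := by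
  let k (j : ℕ) : ℕ := Nat.findGreatest (HasSubspaceBelow (T j) (E + ε)) (Module.finrank ℝ F)
  have hk (j : ℕ) : HasSubspaceBelow (T j) (E + ε) (k j) :=
    Nat.findGreatest_spec (Nat.zero_le _) (hasSubspaceBelow_zero _ _)
  have hmax (j q : ℕ) (hq : HasSubspaceBelow (T j) (E + ε) q) : q ≤ k j :=
    Nat.le_findGreatest hq.le_finrank hq
  suffices ((Finset.range J).filter fun j => Resonant (T j) E ε).card + k J ≤ k 0 from
    (Nat.le_add_right _ _).trans (this.trans (hk 0).le_finrank)
  induction J with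
  | zero => simp
  | succ J ih =>
    rw [Finset.range_add_one, Finset.filter_insert]
    split_ifs with hr
    · rw [Finset.card_insert_of_notMem (by simp)]
      have := hmax J _ ((hk (J + 1)).succ_of_resonant (hT J) hε (hle J) hr)
      omega
    · have := hmax J _ (((hk (J + 1)).mono_form (hle J)).mono_level (by linarith))
      omega

open Classical in
theorem card_common_resonance_le {F' : Type*} [NormedAddCommGroup F'] [InnerProductSpace ℝ F']
    [FiniteDimensional ℝ F'] (T : ℕ → F →ₗ[ℝ] F) (hT : ∀ j, (T j).IsSymmetric)
    {T' : F' →ₗ[ℝ] F'} (hT' : T'.IsSymmetric) {ε : ℝ} (hε : 0 < ε)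
    (hle : ∀ j ψ, inner ℝ ψ (T j ψ) + 6 * ε * ‖ψ‖ ^ 2 ≤ inner ℝ ψ (T (j + 1) ψ)) (J : ℕ) :
    ((Finset.range J).filter fun j => ∃ E, Resonant (T j) E ε ∧ Resonant T' E ε).card ≤
      Module.finrank ℝ F * Module.finrank ℝ F' := by
  have hsub : ((Finset.range J).filter fun j => ∃ E, Resonant (T j) E ε ∧ Resonant T' E ε) ⊆
      Finset.univ.biUnion fun i : Fin (Module.finrank ℝ F') =>
        (Finset.range J).filter fun j => Resonant (T j) (hT'.eigenvalues rfl i) (2 * ε) := by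
    intro j hj
    obtain ⟨hj, E, hE, hE'⟩ := Finset.mem_filter.1 hj
    obtain ⟨i, hi⟩ := hE'.exists_eigenvalue hT' rfl hε.le
    refine Finset.mem_biUnion.2 ⟨i, Finset.mem_univ i, Finset.mem_filter.2 ⟨hj, ?_⟩⟩
    rw [two_mul]
    exact hE.change_energy (abs_sub_comm E _ ▸ hi)
  calc _ ≤ ∑ i : Fin (Module.finrank ℝ F'), ((Finset.range J).filter fun j =>
          Resonant (T j) (hT'.eigenvalues rfl i) (2 * ε)).card :=
        (Finset.card_le_card hsub).trans Finset.card_biUnion_le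
    _ ≤ ∑ _i : Fin (Module.finrank ℝ F'), Module.finrank ℝ F :=
        Finset.sum_le_sum fun i _ => card_resonant_le T hT (by positivity)
          (fun j ψ => by linarith [hle j ψ]) J
    _ = Module.finrank ℝ F * Module.finrank ℝ F' := by simp [mul_comm]

end Symmetric

section Matrix

variable {n : Type*} [Fintype n] [DecidableEq n] {M : Matrix n n ℝ} {E ε : ℝ}

theorem notMem_spectrum_iff_isUnit_det :
    E ∉ spectrum ℝ M ↔ IsUnit (M - E • (1 : Matrix n n ℝ)).det := by
  rw [spectrum.notMem_iff, ← IsUnit.neg_iff, neg_sub, Algebra.algebraMap_eq_smul_one,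
    Matrix.isUnit_iff_isUnit_det]

theorem isUnit_det_of_not_resonant (hε : 0 ≤ ε) (h : ¬ Resonant (Matrix.toEuclideanLin M) E ε) :
    IsUnit (M - E • (1 : Matrix n n ℝ)).det := by
  rw [isUnit_iff_ne_zero]
  intro h0
  obtain ⟨φ, hφ, hz⟩ := Matrix.exists_mulVec_eq_zero_iff.2 h0
  refine h ⟨WithLp.toLp 2 φ, by simpa using hφ, ?_⟩
  have hzero : Matrix.toEuclideanLin M (WithLp.toLp 2 φ) - E • WithLp.toLp 2 φ = 0 := by
    rw [Matrix.toLpLin_toLp, ← WithLp.toLp_smul, ← WithLp.toLp_sub, WithLp.toLp_eq_zero]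
    simpa [Matrix.sub_mulVec, Matrix.smul_mulVec] using hz
  rw [hzero, norm_zero]
  positivity

theorem abs_inv_apply_le_of_not_resonant (hε : 0 < ε)
    (h : ¬ Resonant (Matrix.toEuclideanLin M) E ε) (x y : n) :
    |(M - E • (1 : Matrix n n ℝ))⁻¹ x y| ≤ 1 / ε := by
  set G := (M - E • (1 : Matrix n n ℝ))⁻¹
  let φ : EuclideanSpace ℝ n := WithLp.toLp 2 (G.col y)
  have hφ : Matrix.toEuclideanLin M φ - E • φ = EuclideanSpace.single y 1 := by
    have hG : (M - E • (1 : Matrix n n ℝ)) * G = 1 :=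
      Matrix.mul_nonsing_inv _ (isUnit_det_of_not_resonant hε.le h)
    ext i
    rw [Matrix.sub_mul, Matrix.smul_mul, Matrix.one_mul] at hG
    simpa [φ, Matrix.mul_apply, Matrix.mulVec, dotProduct, Matrix.one_apply,
      Pi.single_apply] using congrFun (congrFun hG i) y
  calc |G x y| = ‖φ x‖ := rfl
    _ ≤ ‖φ‖ := PiLp.norm_apply_le φ x
    _ ≤ ‖Matrix.toEuclideanLin M φ - E • φ‖ / ε := norm_le_of_not_resonant hε h φ
    _ = 1 / ε := by simp [hφ]

end Matrix

end AlloyMSA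

/-! ### A direction along which the potential changes by a constant -/

namespace AlloyMSA

section Moments

open ProbabilityTheory

variable {ν ν' : Measure ℝ}

theorem complexMGF_eventuallyEq_of_moments_eq (hν : 0 ∈ interior (integrableExpSet id ν))
    (hν' : 0 ∈ interior (integrableExpSet id ν'))
    (hmom : ∀ n : ℕ, ∫ t, t ^ n ∂ν = ∫ t, t ^ n ∂ν') :
    complexMGF id ν =ᶠ[nhds 0] complexMGF id ν' := by
  have hderiv {κ : Measure ℝ} (hκ : 0 ∈ interior (integrableExpSet id κ)) (n : ℕ) :
      iteratedDeriv n (complexMGF id κ) 0 = (∫ t, t ^ n ∂κ : ℝ) := by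
    rw [iteratedDeriv_complexMGF (by simpa using hκ), ← integral_complex_ofReal]
    simp
  have hseries := (analyticAt_complexMGF (z := 0) (by simpa using hν)).hasFPowerSeriesAt
  have hseries' := (analyticAt_complexMGF (z := 0) (by simpa using hν')).hasFPowerSeriesAt
  simp only [hderiv hν, hmom] at hseries
  simp only [hderiv hν'] at hseries'
  have hsub := hseries.sub hseries'
  rw [sub_self] at hsub
  filter_upwards [hsub.eventually_eq_zero] with z hz
  exact sub_eq_zero.1 hz

theorem eq_of_moments_eq [IsFiniteMeasure ν] [IsFiniteMeasure ν']
    (hν : 0 ∈ interior (integrableExpSet id ν)) (hν' : 0 ∈ interior (integrableExpSet id ν'))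
    (hmom : ∀ n : ℕ, ∫ t, t ^ n ∂ν = ∫ t, t ^ n ∂ν') : ν = ν' := by
  let strip : Set ℂ :=
    Complex.re ⁻¹' (interior (integrableExpSet id ν) ∩ interior (integrableExpSet id ν'))
  have hstrip : IsPreconnected strip :=
    ((convex_integrableExpSet.interior.inter convex_integrableExpSet.interior).linear_preimage
      Complex.reLm).isPreconnected
  have hmgf : EqOn (complexMGF id ν) (complexMGF id ν') strip :=
    (analyticOnNhd_complexMGF.mono fun _ hz => hz.1).eqOn_of_preconnected_of_eventuallyEq
      (analyticOnNhd_complexMGF.mono fun _ hz => hz.2) hstrip (z₀ := 0) ⟨hν, hν'⟩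
      (complexMGF_eventuallyEq_of_moments_eq hν hν' hmom)
  refine Measure.ext_of_charFun (funext fun t => ?_)
  rw [← complexMGF_id_mul_I, ← complexMGF_id_mul_I]
  exact hmgf (by simpa [strip] using ⟨hν, hν'⟩)

end Moments

section PointMasses

open ProbabilityTheory

variable {ι : Type*}

theorem summable_abs_mul_pow {w x : ι → ℝ} {δ : ℝ} (hδ : 0 < δ)
    (hs : Summable fun j => |w j| * Real.exp (δ * |x j|)) (n : ℕ) :
    Summable fun j => |w j| * |x j| ^ n := by
  refine Summable.of_nonneg_of_le (fun j => by positivity) (fun j => ?_)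
    (hs.mul_left (n.factorial / δ ^ n))
  have hpow : |x j| ^ n ≤ n.factorial / δ ^ n * Real.exp (δ * |x j|) := by
    have := Real.pow_div_factorial_le_exp (δ * |x j|) (by positivity) n
    rwa [div_mul_eq_mul_div, le_div_iff₀ (by positivity), ← div_le_iff₀' (by positivity),
      mul_comm, ← mul_pow]
  calc |w j| * |x j| ^ n ≤ |w j| * (n.factorial / δ ^ n * Real.exp (δ * |x j|)) := by gcongr
    _ = n.factorial / δ ^ n * (|w j| * Real.exp (δ * |x j|)) := by ring

/-- The positive part of the signed measure `∑ⱼ wⱼ δ_{xⱼ}`, for distinct points `xⱼ`; its negative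
part is obtained from the weights `-w`. -/
noncomputable def pointMasses (w x : ι → ℝ) : Measure ℝ :=
  Measure.sum fun j => ENNReal.ofReal (w j) • Measure.dirac (x j)

theorem pointMasses_singleton (w : ι → ℝ) {x : ι → ℝ} (hx : Function.Injective x) (j : ι) :
    pointMasses w x {x j} = ENNReal.ofReal (w j) := by
  rw [pointMasses, Measure.sum_apply _ (measurableSet_singleton _), tsum_eq_single j]
  · simp
  · intro i hi
    simp [hx.ne hi]

variable [Countable ι]

theorem integral_pointMasses (w x : ι → ℝ) (f : ℝ → ℝ) :
    ∫ t, f t ∂(pointMasses w x) = ∑' j, max (w j) 0 * f (x j) := by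
  rw [pointMasses, integral_sum_dirac fun _ => ENNReal.ofReal_ne_top]
  simp only [ENNReal.toReal_ofReal', smul_eq_mul]

variable {w x : ι → ℝ} {δ : ℝ}

theorem integrable_pointMasses (hs : Summable fun j => |w j| * Real.exp (δ * |x j|))
    {f : ℝ → ℝ} (hf : ∀ t, |f t| ≤ Real.exp (δ * |t|)) : Integrable f (pointMasses w x) := by
  refine (integrable_sum_dirac_iff fun _ => ENNReal.ofReal_ne_top).2
    (Summable.of_nonneg_of_le (fun j => by positivity) (fun j => ?_) hs)
  rw [ENNReal.toReal_ofReal']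
  exact mul_le_mul (max_le (le_abs_self _) (abs_nonneg _)) (hf _) (norm_nonneg _) (abs_nonneg _)

theorem isFiniteMeasure_pointMasses (hδ : 0 ≤ δ)
    (hs : Summable fun j => |w j| * Real.exp (δ * |x j|)) :
    IsFiniteMeasure (pointMasses w x) := by
  rw [← integrable_const_iff_isFiniteMeasure (one_ne_zero (α := ℝ))]
  refine integrable_pointMasses hs fun t => ?_
  rw [abs_one, Real.one_le_exp_iff]
  positivity

theorem zero_mem_interior_integrableExpSet_pointMasses (hδ : 0 < δ)
    (hs : Summable fun j => |w j| * Real.exp (δ * |x j|)) :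
    0 ∈ interior (integrableExpSet id (pointMasses w x)) := by
  have hsub : Ioo (-δ) δ ⊆ interior (integrableExpSet id (pointMasses w x)) := by
    refine interior_maximal (fun t ht => integrable_pointMasses hs fun s => ?_) isOpen_Ioo
    rw [Real.abs_exp, Real.exp_le_exp]
    calc t * s ≤ |t| * |s| := (le_abs_self _).trans (abs_mul t s).le
      _ ≤ δ * |s| := by gcongr; exact (abs_lt.2 ht).le
  exact hsub ⟨neg_lt_zero.2 hδ, hδ⟩

theorem integral_pow_pointMasses_eq_neg (hδ : 0 < δ)
    (hs : Summable fun j => |w j| * Real.exp (δ * |x j|)) {n : ℕ}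
    (hm : ∑' j, w j * x j ^ n = 0) :
    ∫ t, t ^ n ∂(pointMasses w x) = ∫ t, t ^ n ∂(pointMasses (-w) x) := by
  have hsum (v : ι → ℝ) (hv : ∀ j, |v j| = |w j|) :
      Summable fun j => max (v j) 0 * x j ^ n := by
    refine Summable.of_norm_bounded (summable_abs_mul_pow hδ hs n) fun j => ?_
    rw [norm_mul, norm_pow, Real.norm_eq_abs, Real.norm_eq_abs, ← hv j,
      abs_of_nonneg (le_max_right _ _)]
    gcongr
    exact max_le (le_abs_self _) (abs_nonneg _)
  rw [integral_pointMasses, integral_pointMasses, ← sub_eq_zero,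
    ← (hsum w fun _ => rfl).tsum_sub (hsum (-w) fun _ => abs_neg _)]
  refine Eq.trans (tsum_congr fun j => ?_) hm
  rw [← sub_mul, Pi.neg_apply, max_zero_sub_max_neg_zero_eq_self]

theorem eq_zero_of_moments_eq_zero (hδ : 0 < δ) (hx : Function.Injective x)
    (hs : Summable fun j => |w j| * Real.exp (δ * |x j|))
    (hm : ∀ n : ℕ, ∑' j, w j * x j ^ n = 0) : w = 0 := by
  have hs' : Summable fun j => |(-w) j| * Real.exp (δ * |x j|) := by
    simpa only [Pi.neg_apply, abs_neg] using hs
  have := isFiniteMeasure_pointMasses hδ.le hs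
  have := isFiniteMeasure_pointMasses hδ.le hs'
  have heq : pointMasses w x = pointMasses (-w) x :=
    eq_of_moments_eq (zero_mem_interior_integrableExpSet_pointMasses hδ hs)
      (zero_mem_interior_integrableExpSet_pointMasses hδ hs')
      fun n => integral_pow_pointMasses_eq_neg hδ hs (hm n)
  ext j
  have hj : ENNReal.ofReal (w j) = ENNReal.ofReal (-w j) := by
    rw [← pointMasses_singleton w hx, heq, pointMasses_singleton (-w) hx, Pi.neg_apply]
  rcases le_total 0 (w j) with h | h
  · rw [ENNReal.ofReal_of_nonpos (neg_nonpos.2 h), ENNReal.ofReal_eq_zero] at hj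
    exact le_antisymm hj h
  · rw [ENNReal.ofReal_of_nonpos h, eq_comm, ENNReal.ofReal_eq_zero, neg_nonpos] at hj
    exact le_antisymm h hj

end PointMasses

theorem hasSum_pow_mul_sub_of_moments_eq_zero {G : Type*} [AddCommGroup G] (ℓ : G →+ ℝ)
    {u : G → ℝ} {n : ℕ} (hs : ∀ p, Summable fun j => u j * ℓ j ^ p)
    (h0 : ∀ p < n, ∑' j, u j * ℓ j ^ p = 0) (x₀ x : G) :
    HasSum (fun k => ℓ (k - x₀) ^ n * u (x - k)) ((-1) ^ n * ∑' j, u j * ℓ j ^ n) := by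
  set y : ℝ := ℓ (x - x₀)
  let coeff (p : ℕ) : ℝ := (-1) ^ p * y ^ (n - p) * n.choose p
  have hexpand (j : G) : ℓ (x - j - x₀) ^ n * u (x - (x - j)) =
      ∑ p ∈ Finset.range (n + 1), coeff p * (u j * ℓ j ^ p) := by
    have hshift : ℓ (x - j - x₀) = -ℓ j + y := by
      rw [sub_right_comm, map_sub]
      ring
    rw [hshift, sub_sub_cancel, add_pow, Finset.sum_mul]
    refine Finset.sum_congr rfl fun p _ => ?_
    simp only [neg_pow (ℓ j), coeff]
    ring
  have hsum : HasSum (fun j => ∑ p ∈ Finset.range (n + 1), coeff p * (u j * ℓ j ^ p))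
      (∑ p ∈ Finset.range (n + 1), coeff p * ∑' j, u j * ℓ j ^ p) :=
    hasSum_sum fun p _ => (hs p).hasSum.mul_left _
  rw [Finset.sum_range_succ, Finset.sum_eq_zero fun p hp => by
    rw [h0 p (Finset.mem_range.1 hp), mul_zero]] at hsum
  simp only [coeff, Nat.sub_self, pow_zero, mul_one, Nat.choose_self, Nat.cast_one,
    zero_add] at hsum
  exact (Equiv.subLeft x).hasSum_iff.1 (hsum.congr_fun hexpand)

section Lattice

variable {d : ℕ}

theorem norm1_nonneg (k : Site d) : 0 ≤ norm1 k :=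
  Finset.sum_nonneg fun _ _ => abs_nonneg _

theorem summable_pi_prod_of_nonneg {α : Type*} {f : α → ℝ} (h0 : ∀ k, 0 ≤ f k) (hf : Summable f)
    (d : ℕ) : Summable fun k : Fin d → α => ∏ i, f (k i) := by
  induction d with
  | zero => exact (hasSum_fintype _).summable
  | succ d ih =>
    rw [← (Fin.consEquiv fun _ => α).summable_iff]
    refine (hf.mul_of_nonneg ih h0 fun k => Finset.prod_nonneg fun i _ => h0 _).congr fun p => ?_
    simp [Fin.prod_univ_succ]

theorem summable_exp_norm1 (d : ℕ) {c : ℝ} (hc : 0 < c) :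
    Summable fun k : Site d => Real.exp (-c * (norm1 k : ℝ)) := by
  have hnat : Summable fun n : ℕ => Real.exp (-c * (n : ℝ)) := by
    simpa only [mul_comm] using Real.summable_exp_nat_mul_iff.2 (neg_lt_zero.2 hc)
  have hint : Summable fun k : ℤ => Real.exp (-c * |(k : ℝ)|) :=
    Summable.of_nat_of_neg (by simpa using hnat) (by simpa using hnat)
  refine (summable_pi_prod_of_nonneg (fun k => (Real.exp_pos _).le) hint d).congr fun k => ?_
  rw [← Real.exp_sum, ← Finset.mul_sum]
  simp [norm1]

theorem exists_injective_addMonoidHom (d : ℕ) : ∃ ℓ : Site d →+ ℝ, Function.Injective ℓ := by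
  have ht : Transcendental ℤ (liouvilleNumber 2) := transcendental_liouvilleNumber le_rfl
  have hpow : LinearIndependent ℤ fun n : ℕ => liouvilleNumber 2 ^ n := by
    simpa [Function.comp_def] using (Polynomial.basisMonomials ℤ).linearIndependent.map'
      (Polynomial.aeval (liouvilleNumber 2)).toLinearMap
      (LinearMap.ker_eq_bot.2 (transcendental_iff_injective.1 ht))
  exact ⟨(Fintype.linearCombination ℤ fun i : Fin d => liouvilleNumber 2 ^ (i : ℕ)).toAddMonoidHom,
    linearIndependent_iff_injective_fintypeLinearCombination.1 (hpow.comp _ Fin.val_injective)⟩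

theorem exists_abs_le_mul_norm1 (ℓ : Site d →+ ℝ) :
    ∃ Θ : ℝ, 0 < Θ ∧ ∀ k, |ℓ k| ≤ Θ * norm1 k := by
  let Θ : ℝ := ∑ i, |ℓ (Pi.single i 1)|
  refine ⟨Θ + 1, by positivity, fun k => ?_⟩
  have hk : ℓ k = ∑ i, k i * ℓ (Pi.single i 1) := by
    conv_lhs => rw [← Finset.univ_sum_single k, map_sum]
    refine Finset.sum_congr rfl fun i _ => ?_
    rw [← zsmul_eq_mul, ← map_zsmul, ← Pi.single_smul, smul_eq_mul, mul_one]
  calc |ℓ k| ≤ ∑ i, |(k i : ℝ)| * |ℓ (Pi.single i 1)| := by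
        rw [hk]
        simpa only [abs_mul] using
          Finset.abs_sum_le_sum_abs (fun i => (k i : ℝ) * ℓ (Pi.single i 1)) Finset.univ
    _ ≤ ∑ i, |(k i : ℝ)| * (Θ + 1) := by
        gcongr with i
        exact (Finset.single_le_sum (f := fun i => |ℓ (Pi.single i 1)|)
          (fun _ _ => abs_nonneg _) (Finset.mem_univ i)).trans (le_add_of_nonneg_right zero_le_one)
    _ = (Θ + 1) * norm1 k := by
        rw [← Finset.sum_mul, mul_comm]
        simp [norm1]

variable {u : Site d → ℝ}

theorem ExpDecay.exists_summable_mul_exp (hu : ExpDecay u) (ℓ : Site d →+ ℝ) :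
    ∃ δ : ℝ, 0 < δ ∧ Summable fun j => |u j| * Real.exp (δ * |ℓ j|) := by
  obtain ⟨C, α, hC, hα, hb⟩ := hu
  obtain ⟨Θ, hΘ, hℓ⟩ := exists_abs_le_mul_norm1 ℓ
  refine ⟨α / 2 / Θ, by positivity, Summable.of_nonneg_of_le (fun j => by positivity)
    (fun j => ?_) ((summable_exp_norm1 d (half_pos hα)).mul_left C)⟩
  calc |u j| * Real.exp (α / 2 / Θ * |ℓ j|)
      ≤ C * Real.exp (-α * norm1 j) * Real.exp (α / 2 / Θ * (Θ * norm1 j)) := by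
        gcongr
        exacts [hb j, hℓ j]
    _ = C * Real.exp (-(α / 2) * norm1 j) := by
        rw [mul_assoc, ← Real.exp_add]
        congr 2
        field_simp
        ring

-- With `n` the order of the first non-vanishing moment of `u` under an injective linear form `ℓ`,
-- the convolution of `ℓ ^ n` with `u` is constant.
theorem exists_forall_hasSum_one (hu : ExpDecay u) (hu0 : u ≠ 0) :
    ∃ (Q : ℝ) (n : ℕ), 0 < Q ∧ ∀ x₀ : Site d, ∃ a : Site d → ℝ,
      (∀ k, |a k| ≤ Q * norm1 (k - x₀) ^ n) ∧ ∀ x, HasSum (fun k => a k * u (x - k)) 1 := by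
  classical
  obtain ⟨ℓ, hℓ⟩ := exists_injective_addMonoidHom d
  obtain ⟨δ, hδ, hsum⟩ := hu.exists_summable_mul_exp ℓ
  obtain ⟨Θ, hΘ, hℓΘ⟩ := exists_abs_le_mul_norm1 ℓ
  have hex : ∃ n : ℕ, ∑' j, u j * ℓ j ^ n ≠ 0 := by
    by_contra! hzero
    exact hu0 (eq_zero_of_moments_eq_zero hδ hℓ hsum hzero)
  set n := Nat.find hex
  have hs (p : ℕ) : Summable fun j => u j * ℓ j ^ p :=
    Summable.of_norm_bounded (summable_abs_mul_pow hδ hsum p) fun j => by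
      rw [norm_mul, norm_pow, Real.norm_eq_abs, Real.norm_eq_abs]
  have hconv := hasSum_pow_mul_sub_of_moments_eq_zero ℓ hs fun p hp =>
    not_not.1 (Nat.find_min hex hp)
  set c : ℝ := (-1) ^ n * ∑' j, u j * ℓ j ^ n
  have hc : c ≠ 0 := mul_ne_zero (by simp) (Nat.find_spec hex)
  refine ⟨|c|⁻¹ * Θ ^ n, n, by positivity, fun x₀ => ⟨fun k => c⁻¹ * ℓ (k - x₀) ^ n,
    fun k => ?_, fun x => ?_⟩⟩
  · rw [abs_mul, abs_inv, abs_pow, mul_assoc, ← mul_pow]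
    gcongr
    exact hℓΘ _
  · simpa only [mul_assoc, inv_mul_cancel₀ hc] using (hconv x₀ x).mul_left c⁻¹

end Lattice

end AlloyMSA

/-! ### Schrödinger operators on finite boxes -/

namespace AlloyMSA

section BoxOperator

variable {d : ℕ}

/-- The matrix of `h₀ + v` with respect to the standard basis `(δ_x)`, for a potential `v` on
`ℤ^d`. -/
noncomputable def latticeMatrix (v : Site d → ℝ) : Matrix (Site d) (Site d) ℝ :=
  Matrix.of fun x y =>
    (∑ z ∈ neighbors x, ((Pi.single y 1 : Site d → ℝ) x - (Pi.single y 1 : Site d → ℝ) z)) +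
      v x * (Pi.single y 1 : Site d → ℝ) x

/-- The matrix of the compression of `h₀ + v` to `ℓ²(S)`. -/
noncomputable def boxMatrix (v : Site d → ℝ) (S : Finset (Site d)) : Matrix S S ℝ :=
  (latticeMatrix v).submatrix (↑) (↑)

/-- The compression of `h₀ + v` to `ℓ²(S)`. -/
noncomputable def boxOperator (v : Site d → ℝ) (S : Finset (Site d)) :
    EuclideanSpace ℝ S →ₗ[ℝ] EuclideanSpace ℝ S :=
  Matrix.toEuclideanLin (boxMatrix v S)

theorem norm1_sub_comm (x y : Site d) : norm1 (x - y) = norm1 (y - x) :=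
  Finset.sum_congr rfl fun _ _ => abs_sub_comm _ _

theorem latticeMatrix_apply_of_ne (v : Site d → ℝ) {x y : Site d} (h : x ≠ y) :
    latticeMatrix v x y = if norm1 (x - y) = 1 then -1 else 0 := by
  simp only [latticeMatrix, Matrix.of_apply, Pi.single_apply, if_neg h, mul_zero, add_zero,
    zero_sub, Finset.sum_neg_distrib, Finset.sum_ite_eq', mem_neighbors]
  split_ifs <;> simp

theorem latticeMatrix_comm (v : Site d → ℝ) (x y : Site d) :
    latticeMatrix v x y = latticeMatrix v y x := by
  rcases eq_or_ne x y with rfl | h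
  · rfl
  · rw [latticeMatrix_apply_of_ne v h, latticeMatrix_apply_of_ne v h.symm, norm1_sub_comm]

theorem boxMatrix_eq_add_diagonal (v v' : Site d → ℝ) (S : Finset (Site d)) :
    boxMatrix v' S = boxMatrix v S + Matrix.diagonal fun z : S => v' z - v z := by
  ext x y
  simp only [boxMatrix, latticeMatrix, Matrix.submatrix_apply, Matrix.of_apply, Matrix.add_apply,
    Matrix.diagonal_apply, Pi.single_apply, Subtype.ext_iff]
  split_ifs <;> ring

theorem isSymmetric_boxOperator (v : Site d → ℝ) (S : Finset (Site d)) :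
    (boxOperator v S).IsSymmetric :=
  Matrix.isSymmetric_toEuclideanLin_iff.2 (Matrix.IsHermitian.ext fun _ _ => latticeMatrix_comm ..)

theorem boxOperator_apply_apply (v v' : Site d → ℝ) (S : Finset (Site d))
    (φ : EuclideanSpace ℝ S) (z : S) :
    boxOperator v' S φ z = boxOperator v S φ z + (v' z - v z) * φ z := by
  simp [boxOperator, Matrix.toLpLin_apply, boxMatrix_eq_add_diagonal v v',
    Matrix.mulVec_diagonal]

theorem Resonant.change_potential {v v' : Site d → ℝ} {S : Finset (Site d)} {E ε δ : ℝ}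
    (h : Resonant (boxOperator v S) E ε) (hδ : 0 ≤ δ) (hv : ∀ z ∈ S, |v' z - v z| ≤ δ) :
    Resonant (boxOperator v' S) E (ε + δ) := by
  refine h.perturb fun φ => ?_
  refine abs_le_of_sq_le_sq' ?_ (by positivity) |>.2
  rw [mul_pow, EuclideanSpace.real_norm_sq_eq, EuclideanSpace.real_norm_sq_eq, Finset.mul_sum]
  refine Finset.sum_le_sum fun z _ => ?_
  rw [sub_sub_sub_cancel_right, PiLp.sub_apply, boxOperator_apply_apply v v', add_sub_cancel_left,
    mul_pow]
  exact mul_le_mul_of_nonneg_right (sq_le_sq' (abs_le.1 (hv z z.2)).1 (abs_le.1 (hv z z.2)).2)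
    (sq_nonneg _)

theorem inner_boxOperator_add_le {v v' : Site d → ℝ} {S : Finset (Site d)} {c : ℝ}
    (hv : ∀ z ∈ S, v z + c ≤ v' z) (ψ : EuclideanSpace ℝ S) :
    inner ℝ ψ (boxOperator v S ψ) + c * ‖ψ‖ ^ 2 ≤ inner ℝ ψ (boxOperator v' S ψ) := by
  rw [EuclideanSpace.real_norm_sq_eq, PiLp.inner_apply, PiLp.inner_apply, Finset.mul_sum,
    ← Finset.sum_add_distrib]
  refine Finset.sum_le_sum fun z _ => ?_
  have hz : 0 ≤ (v' z - v z - c) * ψ z ^ 2 :=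
    mul_nonneg (by linarith [hv z z.2]) (sq_nonneg _)
  rw [boxOperator_apply_apply v v' S ψ z]
  simp only [RCLike.inner_apply, conj_trivial]
  linarith

end BoxOperator

/-! ### Locality of the alloy-type potential -/

section Geometry

variable {d : ℕ}

theorem abs_apply_le_norm1 (k : Site d) (i : Fin d) : |(k i : ℝ)| ≤ norm1 k := by
  exact_mod_cast Finset.single_le_sum (f := fun i => |k i|) (fun _ _ => abs_nonneg _)
    (Finset.mem_univ i)

theorem norm1_add_le (x y : Site d) : norm1 (x + y) ≤ norm1 x + norm1 y := by
  simp only [norm1, ← Finset.sum_add_distrib]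
  exact Finset.sum_le_sum fun i _ => abs_add_le _ _

theorem norm1_sub_le_of_mem_cube {l : ℝ} {x z : Site d} (h : z ∈ cube l x) :
    (norm1 (z - x) : ℝ) ≤ d * l := by
  simp only [norm1, Pi.sub_apply, Int.cast_sum, Int.cast_abs, Int.cast_sub]
  simpa using Finset.sum_le_card_nsmul Finset.univ _ l fun i _ => mem_cube.1 h i

theorem lt_norm1_sub_of_notMem_cube {l r : ℝ} {x z k : Site d} (hz : z ∈ cube l x)
    (hk : k ∉ cube r x) : r - l < norm1 (z - k) := by
  obtain ⟨i, hi⟩ : ∃ i, r < |(k i : ℝ) - x i| := by simpa [mem_cube] using hk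
  have hzk : |(z i : ℝ) - k i| ≤ norm1 (z - k) := by simpa using abs_apply_le_norm1 (z - k) i
  have htri := abs_sub_le (k i : ℝ) (z i) (x i)
  rw [abs_sub_comm (k i : ℝ) (z i)] at htri
  linarith [mem_cube.1 hz i]

end Geometry

theorem abs_sub_sum_le_tsum {ι : Type*} {f g : ι → ℝ} {s : ℝ} (hf : HasSum f s)
    (Λ : Finset ι) (hg : Summable g) (hg0 : 0 ≤ g) (h : ∀ k ∉ Λ, |f k| ≤ g k) :
    |s - ∑ k ∈ Λ, f k| ≤ ∑' k, g k := by
  have hcompl : HasSum (fun k : {k // k ∉ Λ} => f k) (s - ∑ k ∈ Λ, f k) :=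
    (Finset.hasSum_compl_iff Λ).2 (by rwa [sub_add_cancel])
  exact (hcompl.norm_le_of_bounded (hg.subtype _).hasSum fun k => h k k.2).trans
    (Summable.tsum_subtype_le g {k | k ∉ Λ} hg0 hg)

section Potential

variable {d : ℕ} {u : Site d → ℝ}

theorem summable_exp_norm1_mul_pow (d : ℕ) {c : ℝ} (hc : 0 < c) (n : ℕ) :
    Summable fun k : Site d => Real.exp (-c * norm1 k) * (norm1 k : ℝ) ^ n := by
  have hnonneg (k : Site d) : (0 : ℝ) ≤ norm1 k := by exact_mod_cast norm1_nonneg k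
  refine (summable_abs_mul_pow (w := fun k : Site d => Real.exp (-c * norm1 k))
    (x := fun k => (norm1 k : ℝ)) (half_pos hc)
    ((summable_exp_norm1 d (half_pos hc)).congr fun k => ?_) n).congr fun k => by
      rw [Real.abs_exp, abs_of_nonneg (hnonneg k)]
  rw [Real.abs_exp, abs_of_nonneg (hnonneg k), ← Real.exp_add]
  ring_nf

theorem ExpDecay.exists_tail_le (hu : ExpDecay u) (n : ℕ) :
    ∃ K c : ℝ, 0 < K ∧ 0 < c ∧ ∀ (L B s : ℝ) (x z : Site d) (b : Site d → ℝ), 0 ≤ L → 0 ≤ B →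
      z ∈ cube L x → (∀ k ∉ cube (4 * L) x, |b k| ≤ B * norm1 (z - k) ^ n) →
      HasSum (fun k => b k * u (z - k)) s →
      |s - ∑ k ∈ cube (4 * L) x, b k * u (z - k)| ≤ B * (K * Real.exp (-c * L)) := by
  obtain ⟨C, α, hC, hα, hb⟩ := hu
  let g (k : Site d) : ℝ := Real.exp (-(α / 2) * norm1 k) * (norm1 k : ℝ) ^ n
  have hg : Summable g := summable_exp_norm1_mul_pow d (half_pos hα) n
  have hg0 (k : Site d) : 0 ≤ g k :=
    mul_nonneg (Real.exp_nonneg _) (pow_nonneg (by exact_mod_cast norm1_nonneg k) _)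
  have hsum0 : 0 ≤ ∑' k, g k := tsum_nonneg hg0
  refine ⟨C * (∑' k, g k + 1), α / 2, by positivity, half_pos hα,
    fun L B s x z b hL hB hz hbB hs => ?_⟩
  have hbound (k : Site d) (hk : k ∉ cube (4 * L) x) :
      |b k * u (z - k)| ≤ B * C * Real.exp (-(α / 2) * L) * g (z - k) := by
    have hfar := lt_norm1_sub_of_notMem_cube hz hk
    rw [abs_mul]
    calc |b k| * |u (z - k)|
        ≤ B * norm1 (z - k) ^ n * (C * Real.exp (-α * norm1 (z - k))) :=
          mul_le_mul (hbB k hk) (hb _) (abs_nonneg _) ((abs_nonneg _).trans (hbB k hk))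
      _ ≤ B * norm1 (z - k) ^ n *
          (C * Real.exp (-(α / 2) * L + -(α / 2) * norm1 (z - k))) := by
          gcongr
          · exact (abs_nonneg _).trans (hbB k hk)
          · nlinarith
      _ = B * C * Real.exp (-(α / 2) * L) * g (z - k) := by
          rw [Real.exp_add]
          simp only [g]
          ring
  calc |s - ∑ k ∈ cube (4 * L) x, b k * u (z - k)|
      ≤ ∑' k, B * C * Real.exp (-(α / 2) * L) * g (z - k) :=
        abs_sub_sum_le_tsum hs _ (((Equiv.subLeft z).summable_iff.2 hg).mul_left _)
          (fun k => mul_nonneg (by positivity) (hg0 _)) hbound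
    _ = B * C * Real.exp (-(α / 2) * L) * ∑' k, g k := by
        rw [tsum_mul_left]
        exact congrArg _ ((Equiv.subLeft z).tsum_eq g)
    _ ≤ B * C * Real.exp (-(α / 2) * L) * (∑' k, g k + 1) := by gcongr; linarith
    _ = B * (C * (∑' k, g k + 1) * Real.exp (-(α / 2) * L)) := by ring

theorem exists_bound_support {μ : Measure ℝ} (hμ : Bornology.IsBounded μ.support) :
    ∃ R : ℝ, 0 < R ∧ ∀ t : μ.support, |(t : ℝ)| ≤ R := by
  obtain ⟨R, hR, hRμ⟩ := hμ.exists_pos_norm_le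
  exact ⟨R, hR, fun t => hRμ t t.2⟩

theorem ExpDecay.summable_abs (hu : ExpDecay u) : Summable fun k => |u k| := by
  obtain ⟨C, α, -, hα, hb⟩ := hu
  exact Summable.of_nonneg_of_le (fun k => abs_nonneg _) hb ((summable_exp_norm1 d hα).mul_left C)

theorem summable_potential {μ : Measure ℝ} (hu : ExpDecay u) (hμ : Bornology.IsBounded μ.support)
    (ω : Config d μ) (x : Site d) : Summable fun k => (ω k : ℝ) * u (x - k) := by
  obtain ⟨R, -, hR⟩ := exists_bound_support hμ
  refine Summable.of_norm_bounded
    (((Equiv.subLeft x).summable_iff.2 hu.summable_abs).mul_left R) fun k => ?_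
  rw [norm_mul]
  exact mul_le_mul_of_nonneg_right (hR (ω k)) (norm_nonneg _)

theorem exists_abs_potential_sub_le {μ : Measure ℝ} (hu : ExpDecay u)
    (hμ : Bornology.IsBounded μ.support) :
    ∃ K c : ℝ, 0 < K ∧ 0 < c ∧ ∀ (L : ℝ) (x : Site d) (ω ω' : Config d μ), 0 ≤ L →
      (∀ k ∈ cube (4 * L) x, ω' k = ω k) → ∀ z ∈ cube L x,
        |potential u ω' z - potential u ω z| ≤ K * Real.exp (-c * L) := by
  obtain ⟨R, hR0, hR⟩ := exists_bound_support hμ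
  obtain ⟨K, c, hK, hc, htail⟩ := hu.exists_tail_le 0
  refine ⟨2 * R * K, c, by positivity, hc, fun L x ω ω' hL hω z hz => ?_⟩
  have hsum : HasSum (fun k => ((ω' k : ℝ) - ω k) * u (z - k))
      (potential u ω' z - potential u ω z) := by
    simp only [sub_mul]
    exact (summable_potential hu hμ ω' z).hasSum.sub (summable_potential hu hμ ω z).hasSum
  have h := htail L (2 * R) _ x z _ hL (by positivity) hz (fun k _ => ?_) hsum
  · rwa [Finset.sum_eq_zero fun k hk => by rw [hω k hk, sub_self, zero_mul], sub_zero,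
      ← mul_assoc] at h
  · rw [pow_zero, mul_one]
    linarith [abs_sub (ω' k : ℝ) (ω k), hR (ω' k), hR (ω k)]

theorem norm1_sub_le_of_notMem_cube {L : ℝ} (hL : 0 ≤ L) {x z k : Site d} (hz : z ∈ cube L x)
    (hk : k ∉ cube (4 * L) x) : (norm1 (k - x) : ℝ) ≤ (d + 1) * norm1 (z - k) := by
  have hfar := lt_norm1_sub_of_notMem_cube hz hk
  have htri : (norm1 (k - x) : ℝ) ≤ norm1 (z - k) + norm1 (z - x) := by
    have := norm1_add_le (k - z) (z - x)
    rw [sub_add_sub_cancel, norm1_sub_comm k z] at this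
    exact_mod_cast this
  have hnear : (d : ℝ) * L ≤ d * norm1 (z - k) := by
    gcongr
    linarith
  linarith [norm1_sub_le_of_mem_cube hz]

theorem exists_local_direction (hu : ExpDecay u) (hu0 : u ≠ 0) :
    ∃ (Q L₀ : ℝ) (n : ℕ), 0 ≤ Q ∧ 0 ≤ L₀ ∧ ∀ L, L₀ ≤ L → ∀ x : Site d,
      ∃ a : Site d → ℝ, (∀ k ∈ cube (4 * L) x, |a k| ≤ Q * L ^ n) ∧
        ∀ z ∈ cube L x, 1 / 2 ≤ ∑ k ∈ cube (4 * L) x, a k * u (z - k) := by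
  obtain ⟨Q, n, hQ, hdir⟩ := exists_forall_hasSum_one hu hu0
  obtain ⟨K, c, -, hc, htail⟩ := hu.exists_tail_le n
  have hlim : Filter.Tendsto (fun L : ℝ => Q * (d + 1) ^ n * (K * Real.exp (-c * L)))
      Filter.atTop (nhds 0) := by
    have := Real.tendsto_exp_atBot.comp
      (Filter.tendsto_id.const_mul_atTop_of_neg (neg_lt_zero.2 hc))
    simpa using (this.const_mul K).const_mul (Q * (d + 1) ^ n)
  obtain ⟨L₀, hL₀⟩ := Filter.eventually_atTop.1 (hlim.eventually (ge_mem_nhds one_half_pos))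
  refine ⟨Q * (d * 4) ^ n, max L₀ 0, n, by positivity, le_max_right _ _, fun L hL x => ?_⟩
  have hL0 : 0 ≤ L := (le_max_right _ _).trans hL
  obtain ⟨a, ha, hsum⟩ := hdir x
  have hnonneg (k : Site d) : (0 : ℝ) ≤ norm1 (k - x) := by exact_mod_cast norm1_nonneg _
  refine ⟨a, fun k hk => ?_, fun z hz => ?_⟩
  · calc |a k| ≤ Q * norm1 (k - x) ^ n := ha k
      _ ≤ Q * (d * (4 * L)) ^ n := by
        gcongr
        exacts [hnonneg k, norm1_sub_le_of_mem_cube hk]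
      _ = Q * (d * 4) ^ n * L ^ n := by rw [← mul_assoc, mul_pow, mul_assoc]
  · have h := (htail L (Q * (d + 1) ^ n) 1 x z a hL0 (by positivity) hz (fun k hk => ?_)
      (hsum z)).trans (hL₀ L ((le_max_left _ _).trans hL))
    · linarith [(abs_le.1 h).2]
    · rw [mul_assoc, ← mul_pow]
      refine (ha k).trans ?_
      gcongr
      exacts [hnonneg k, norm1_sub_le_of_notMem_cube hL0 hz hk]

end Potential

end AlloyMSA

/-! ### A Wegner-type estimate for two boxes -/

namespace AlloyMSA

open scoped NNReal

section AffinePotential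

variable {d : ℕ}

theorem continuous_boxMatrix {X : Type*} [TopologicalSpace X] {v : X → Site d → ℝ}
    (hv : ∀ z, Continuous fun x => v x z) (S : Finset (Site d)) :
    Continuous fun x => boxMatrix (v x) S := by
  refine continuous_matrix fun i j => ?_
  simp only [boxMatrix, latticeMatrix, Matrix.submatrix_apply, Matrix.of_apply]
  fun_prop

theorem continuous_boxOperator {X : Type*} [TopologicalSpace X] {v : X → Site d → ℝ}
    (hv : ∀ z, Continuous fun x => v x z) (S : Finset (Site d)) :
    Continuous fun p : X × EuclideanSpace ℝ S => boxOperator (v p.1) S p.2 := by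
  simp only [boxOperator, Matrix.toLpLin_apply]
  exact (PiLp.continuous_toLp _ _).comp (((continuous_boxMatrix hv S).comp
    continuous_fst).matrix_mulVec ((PiLp.continuous_ofLp _ _).comp continuous_snd))

variable {ι : Type*} [Fintype ι]

/-- The potential `v + ∑ᵢ ηᵢ wᵢ`, which depends affinely on the finitely many couplings `ηᵢ`. -/
noncomputable def affinePotential (v : Site d → ℝ) (w : ι → Site d → ℝ) (η : ι → ℝ)
    (z : Site d) : ℝ :=
  v z + ∑ i, η i * w i z

theorem continuous_affinePotential (v : Site d → ℝ) (w : ι → Site d → ℝ) (z : Site d) :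
    Continuous fun η => affinePotential v w η z := by
  unfold affinePotential
  fun_prop

theorem affinePotential_add_nsmul (v : Site d → ℝ) (w : ι → Site d → ℝ) (η a : ι → ℝ) (j : ℕ)
    (z : Site d) :
    affinePotential v w (η + j • a) z = affinePotential v w η z + j * ∑ i, a i * w i z := by
  simp only [affinePotential, Pi.add_apply, Pi.smul_apply, add_mul, Finset.sum_add_distrib,
    Finset.mul_sum, add_assoc]
  simp only [nsmul_eq_mul, mul_assoc]

theorem measurableSet_common_resonance_affinePotential (v₁ v₂ : Site d → ℝ)
    (w₁ w₂ : ι → Site d → ℝ) (S₁ S₂ : Finset (Site d)) (ε : ℝ) :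
    MeasurableSet {η | ∃ E, Resonant (boxOperator (affinePotential v₁ w₁ η) S₁) E ε ∧
      Resonant (boxOperator (affinePotential v₂ w₂ η) S₂) E ε} :=
  measurableSet_common_resonance (continuous_boxOperator (continuous_affinePotential v₁ w₁) S₁)
    (continuous_boxOperator (continuous_affinePotential v₂ w₂) S₂) ε

-- Moving the couplings along `a` raises the spectrum of the first box by at least `6 * ε` per
-- step and leaves the second one fixed, so that few steps produce a common resonance.
theorem measureReal_common_resonance_affinePotential_le {μ : Measure ℝ} [IsProbabilityMeasure μ]
    {V : ℝ≥0} (hV : IsTranslationLipschitz μ V) (v₁ v₂ : Site d → ℝ) {w₁ w₂ : ι → Site d → ℝ}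
    {S₁ S₂ : Finset (Site d)} {a : ι → ℝ} {ε : ℝ} (hε : 0 < ε)
    (ha₁ : ∀ z ∈ S₁, 6 * ε ≤ ∑ i, a i * w₁ i z) (ha₂ : ∀ z, ∑ i, a i * w₂ i z = 0)
    {J : ℕ} (hJ : 0 < J) :
    (Measure.pi fun _ : ι => μ).real
      {η | ∃ E, Resonant (boxOperator (affinePotential v₁ w₁ η) S₁) E ε ∧
        Resonant (boxOperator (affinePotential v₂ w₂ η) S₂) E ε} ≤
      (S₁.card * S₂.card : ℕ) / J + V * (J * ∑ i, |a i|) := by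
  classical
  refine hV.measureReal_pi_le_of_card_le a
    (measurableSet_common_resonance_affinePotential v₁ v₂ w₁ w₂ S₁ S₂ ε) hJ fun η => ?_
  have hfix (j : ℕ) : affinePotential v₂ w₂ (η + j • a) = affinePotential v₂ w₂ η :=
    funext fun z => by rw [affinePotential_add_nsmul, ha₂, mul_zero, add_zero]
  have hraise (j : ℕ) (z : Site d) (hz : z ∈ S₁) : affinePotential v₁ w₁ (η + j • a) z + 6 * ε ≤
      affinePotential v₁ w₁ (η + (j + 1) • a) z := by
    rw [affinePotential_add_nsmul, affinePotential_add_nsmul]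
    push_cast
    linarith [ha₁ z hz]
  have hcount := card_common_resonance_le
    (fun j : ℕ => boxOperator (affinePotential v₁ w₁ (η + j • a)) S₁)
    (fun j => isSymmetric_boxOperator _ _)
    (isSymmetric_boxOperator (affinePotential v₂ w₂ η) S₂) hε
    (fun j => inner_boxOperator_add_le (hraise j)) J
  simpa only [hfix, mem_ofPred_eq, finrank_euclideanSpace, Fintype.card_coe] using hcount

end AffinePotential

section Couplings

variable {d : ℕ} {μ : Measure ℝ}

theorem map_coe_siteMeasure (μ : Measure ℝ) :
    (siteMeasure μ).map (Subtype.val : μ.support → ℝ) = μ := by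
  rw [siteMeasure, (MeasurableEmbedding.subtype_coe
    Measure.isClosed_support.measurableSet).map_comap, Subtype.range_coe]
  exact Measure.restrict_eq_self_of_ae_mem Measure.support_mem_ae

theorem map_coe_restrict_prob [IsProbabilityMeasure μ] (T : Finset (Site d)) :
    (prob d μ).map (fun ω (k : T) => (ω k : ℝ)) = Measure.pi fun _ => μ := by
  have hcoe : Measurable fun (η : T → μ.support) (k : T) => (η k : ℝ) := by fun_prop
  have (_ : T) : SigmaFinite ((siteMeasure μ).map (Subtype.val : μ.support → ℝ)) := by
    rw [map_coe_siteMeasure]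
    infer_instance
  have hcomp : (fun (ω : Config d μ) (k : T) => (ω k : ℝ)) =
      (fun (η : T → μ.support) (k : T) => (η k : ℝ)) ∘ T.restrict := rfl
  rw [hcomp, ← Measure.map_map hcoe (Finset.measurable_restrict T), prob,
    Measure.infinitePi_map_restrict, Measure.pi_map_pi
    (f := fun _ : T => (Subtype.val : μ.support → ℝ)) fun _ => by fun_prop]
  simp_rw [map_coe_siteMeasure]

variable {u : Site d → ℝ}

theorem potential_piecewise (hu : ExpDecay u) (hμ : Bornology.IsBounded μ.support)
    (Λ : Finset (Site d)) (ω ω₀ : Config d μ) (z : Site d) :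
    potential u (Λ.piecewise ω ω₀) z =
      potential u ω₀ z + ∑ k ∈ Λ, ((ω k : ℝ) - ω₀ k) * u (z - k) := by
  have hsub : HasSum (fun k => ((Λ.piecewise ω ω₀ k : ℝ) - ω₀ k) * u (z - k))
      (∑ k ∈ Λ, ((Λ.piecewise ω ω₀ k : ℝ) - ω₀ k) * u (z - k)) :=
    hasSum_sum_of_ne_finset_zero fun k hk => by simp [hk]
  have hsum := (summable_potential hu hμ ω₀ z).hasSum.add hsub
  simp only [sub_mul, add_sub_cancel] at hsum
  rw [potential, hsum.tsum_eq, potential]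
  congr 1
  refine Finset.sum_congr rfl fun k hk => ?_
  rw [Finset.piecewise_eq_of_mem _ _ _ hk, sub_mul]

theorem sum_coe_ite_mem {α : Type*} [DecidableEq α] {T Λ : Finset α} (h : Λ ⊆ T) (f : α → ℝ) :
    (∑ k : T, if (k : α) ∈ Λ then f k else 0) = ∑ k ∈ Λ, f k := by
  rw [Finset.sum_coe_sort T fun k => if k ∈ Λ then f k else 0, Finset.sum_ite_mem,
    Finset.inter_eq_right.2 h]

theorem affinePotential_coe_eq_potential_piecewise (hu : ExpDecay u)
    (hμ : Bornology.IsBounded μ.support) {T Λ : Finset (Site d)} (hΛ : Λ ⊆ T)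
    (ω ω₀ : Config d μ) :
    affinePotential (fun z => potential u ω₀ z - ∑ k ∈ Λ, (ω₀ k : ℝ) * u (z - k))
      (fun (k : T) z => if (k : Site d) ∈ Λ then u (z - k) else 0) (fun k : T => (ω k : ℝ)) =
      potential u (Λ.piecewise ω ω₀) := by
  ext z
  simp only [affinePotential, mul_ite, mul_zero, potential_piecewise hu hμ, sub_mul,
    sum_coe_ite_mem hΛ fun k => (ω k : ℝ) * u (z - k), Finset.sum_sub_distrib]
  ring

end Couplings

section Wegner

variable {d : ℕ} {μ : Measure ℝ} {u : Site d → ℝ}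

theorem exists_nat_div_add_mul_le {A B ε : ℝ} (hA : 0 ≤ A) (hB : 0 ≤ B) (hε : 0 < ε)
    (hε1 : ε ≤ 1) : ∃ J : ℕ, 0 < J ∧ A / J + B * (J * ε) ≤ (A + 2 * B) * √ε := by
  have hsqrt : 0 < √ε := Real.sqrt_pos.2 hε
  have hinv : 1 ≤ (√ε)⁻¹ := (one_le_inv₀ hsqrt).2 (Real.sqrt_le_one.2 hε1)
  have hlower : (√ε)⁻¹ ≤ ⌈(√ε)⁻¹⌉₊ := Nat.le_ceil _
  have hupper : (⌈(√ε)⁻¹⌉₊ : ℝ) ≤ 2 * (√ε)⁻¹ := by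
    linarith [Nat.ceil_lt_add_one (zero_le_one.trans hinv)]
  refine ⟨⌈(√ε)⁻¹⌉₊, Nat.ceil_pos.2 (by positivity), ?_⟩
  calc A / ⌈(√ε)⁻¹⌉₊ + B * (⌈(√ε)⁻¹⌉₊ * ε) ≤ A / (√ε)⁻¹ + B * (2 * (√ε)⁻¹ * ε) := by gcongr
    _ = A * √ε + 2 * B * ((√ε)⁻¹ * ε) := by rw [div_inv_eq_mul]; ring
    _ = (A + 2 * B) * √ε := by rw [inv_mul_eq_div, Real.div_sqrt]; ring

theorem prob_common_resonance_piecewise_le [IsProbabilityMeasure μ] (hu : ExpDecay u)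
    (hμ : Bornology.IsBounded μ.support) {V : ℝ≥0} (hV : IsTranslationLipschitz μ V)
    {Λ₁ Λ₂ S₁ : Finset (Site d)} (hdisj : Disjoint Λ₁ Λ₂) {a : Site d → ℝ}
    (ha : ∀ z ∈ S₁, 1 / 2 ≤ ∑ k ∈ Λ₁, a k * u (z - k)) (S₂ : Finset (Site d)) {ε : ℝ}
    (hε : 0 < ε) (hε1 : ε ≤ 1) (ω₀ : Config d μ) :
    (prob d μ).real {ω | ∃ E,
        Resonant (boxOperator (potential u (Λ₁.piecewise ω ω₀)) S₁) E ε ∧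
        Resonant (boxOperator (potential u (Λ₂.piecewise ω ω₀)) S₂) E ε} ≤
      (S₁.card * S₂.card + 24 * V * ∑ k ∈ Λ₁, |a k|) * √ε := by
  have hmeas : Measurable fun (ω : Config d μ) (k : ↥(Λ₁ ∪ Λ₂)) => (ω k : ℝ) := by fun_prop
  let shift (k : ↥(Λ₁ ∪ Λ₂)) : ℝ := if (k : Site d) ∈ Λ₁ then 12 * ε * a k else 0
  have hshift_sum : ∑ k, |shift k| = 12 * ε * ∑ k ∈ Λ₁, |a k| := by
    simp only [shift, apply_ite abs, abs_zero, abs_mul, abs_of_pos hε, Nat.abs_ofNat,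
      Finset.mul_sum, sum_coe_ite_mem Finset.subset_union_left fun k => 12 * ε * |a k|]
  have hshift₁ (z : Site d) (hz : z ∈ S₁) :
      6 * ε ≤ ∑ k, shift k * if (k : Site d) ∈ Λ₁ then u (z - k) else 0 := by
    simp only [shift, ite_mul_ite, mul_zero, mul_assoc,
      sum_coe_ite_mem Finset.subset_union_left fun k => 12 * (ε * (a k * u (z - k)))]
    rw [← Finset.mul_sum, ← Finset.mul_sum]
    nlinarith [ha z hz]
  have hshift₂ (z : Site d) : ∑ k, shift k * (if (k : Site d) ∈ Λ₂ then u (z - k) else 0) = 0 :=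
    Finset.sum_eq_zero fun k _ => by
      by_cases hk : (k : Site d) ∈ Λ₁
      · rw [if_neg (Finset.disjoint_left.1 hdisj hk), mul_zero]
      · rw [show shift k = 0 from if_neg hk, zero_mul]
  obtain ⟨J, hJ, hJε⟩ := exists_nat_div_add_mul_le (A := S₁.card * S₂.card)
    (B := 12 * V * ∑ k ∈ Λ₁, |a k|) (by positivity) (by positivity) hε hε1
  have hmain := measureReal_common_resonance_affinePotential_le (S₂ := S₂) hV
    (fun z => potential u ω₀ z - ∑ k ∈ Λ₁, (ω₀ k : ℝ) * u (z - k))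
    (fun z => potential u ω₀ z - ∑ k ∈ Λ₂, (ω₀ k : ℝ) * u (z - k)) hε hshift₁ hshift₂ hJ
  rw [← map_coe_restrict_prob, map_measureReal_apply hmeas
    (measurableSet_common_resonance_affinePotential ..), preimage_ofPred_eq, hshift_sum] at hmain
  simp only [affinePotential_coe_eq_potential_piecewise hu hμ Finset.subset_union_left,
    affinePotential_coe_eq_potential_piecewise hu hμ Finset.subset_union_right] at hmain
  push_cast at hmain
  linarith

theorem card_Icc_ceil_floor_le (t : ℝ) {l : ℝ} (hl : 0 ≤ l) :
    ((Finset.Icc ⌈t - l⌉ ⌊t + l⌋).card : ℝ) ≤ 2 * l + 1 := by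
  have hfloor := Int.floor_le (t + l)
  have hceil := Int.le_ceil (t - l)
  rw [Int.card_Icc, ← Int.cast_natCast, Int.toNat_eq_max, Int.cast_max]
  refine max_le ?_ (by push_cast; linarith)
  push_cast
  linarith

theorem card_cube_le {l : ℝ} (hl : 0 ≤ l) (x : Site d) :
    ((cube l x).card : ℝ) ≤ (2 * l + 1) ^ d := by
  rw [cube, Fintype.card_piFinset, Nat.cast_prod]
  simpa using Finset.prod_le_prod (fun i _ => Nat.cast_nonneg _)
    fun i (_ : i ∈ Finset.univ) => card_Icc_ceil_floor_le (x i : ℝ) hl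

theorem card_le_of_subset_cube {S : Finset (Site d)} {l L : ℝ} (hl : 0 ≤ l) (hlL : l ≤ L)
    (hL : 1 ≤ L) {x : Site d} (hS : S ⊆ cube l x) : (S.card : ℝ) ≤ (3 * L) ^ d :=
  calc (S.card : ℝ) ≤ (cube l x).card := by exact_mod_cast Finset.card_le_card hS
    _ ≤ (2 * l + 1) ^ d := card_cube_le hl x
    _ ≤ (3 * L) ^ d := by gcongr; linarith

theorem exists_wegner_piecewise [IsProbabilityMeasure μ] (hu : ExpDecay u) (hu0 : u ≠ 0)
    (hμ : Bornology.IsBounded μ.support) {V : ℝ≥0} (hV : IsTranslationLipschitz μ V) :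
    ∃ (D L₀ : ℝ) (p : ℕ), 0 < D ∧ 1 ≤ L₀ ∧ ∀ L, L₀ ≤ L → ∀ ε : ℝ, 0 < ε → ε ≤ 1 →
      ∀ x y : Site d, Disjoint (cube (4 * L) x) (cube (4 * L) y) →
      ∀ S₁ ⊆ cube L x, ∀ S₂ ⊆ cube L y, ∀ ω₀ : Config d μ,
      (prob d μ).real {ω | ∃ E,
        Resonant (boxOperator (potential u ((cube (4 * L) x).piecewise ω ω₀)) S₁) E ε ∧
        Resonant (boxOperator (potential u ((cube (4 * L) y).piecewise ω ω₀)) S₂) E ε} ≤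
      D * L ^ p * √ε := by
  obtain ⟨Q, L₀, n, hQ, -, hdir⟩ := exists_local_direction hu hu0
  refine ⟨9 ^ d + 24 * V * (12 ^ d * Q), max L₀ 1, 2 * d + n, by positivity, le_max_right _ _,
    fun L hL ε hε hε1 x y hdisj S₁ hS₁ S₂ hS₂ ω₀ => ?_⟩
  have hL1 : 1 ≤ L := (le_max_right _ _).trans hL
  obtain ⟨a, ha, hraise⟩ := hdir L ((le_max_left _ _).trans hL) x
  have hcard : (S₁.card * S₂.card : ℝ) ≤ 9 ^ d * L ^ (2 * d + n) :=
    calc (S₁.card * S₂.card : ℝ) ≤ (3 * L) ^ d * (3 * L) ^ d := by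
          gcongr
          exacts [card_le_of_subset_cube (by linarith) le_rfl hL1 hS₁,
            card_le_of_subset_cube (by linarith) le_rfl hL1 hS₂]
      _ = 9 ^ d * L ^ (2 * d) := by rw [← mul_pow, pow_mul, ← mul_pow]; ring_nf
      _ ≤ 9 ^ d * L ^ (2 * d + n) := by gcongr; lia
  have hdir_sum : ∑ k ∈ cube (4 * L) x, |a k| ≤ 12 ^ d * Q * L ^ (2 * d + n) :=
    calc ∑ k ∈ cube (4 * L) x, |a k| ≤ (cube (4 * L) x).card * (Q * L ^ n) := by
          simpa only [nsmul_eq_mul] using Finset.sum_le_card_nsmul _ _ _ ha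
      _ ≤ (3 * (4 * L)) ^ d * (Q * L ^ n) := by
          gcongr
          exact card_le_of_subset_cube (by linarith) le_rfl (by linarith) subset_rfl
      _ = 12 ^ d * Q * L ^ (d + n) := by
          rw [show 3 * (4 * L) = 12 * L by ring, mul_pow, pow_add]
          ring
      _ ≤ 12 ^ d * Q * L ^ (2 * d + n) := by gcongr; lia
  calc _ ≤ (S₁.card * S₂.card + 24 * V * ∑ k ∈ cube (4 * L) x, |a k|) * √ε :=
        prob_common_resonance_piecewise_le hu hμ hV hdisj (fun z hz => hraise z (hS₁ hz)) S₂ hε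
          hε1 ω₀
    _ ≤ (9 ^ d * L ^ (2 * d + n) + 24 * V * (12 ^ d * Q * L ^ (2 * d + n))) * √ε := by gcongr
    _ = (9 ^ d + 24 * V * (12 ^ d * Q)) * L ^ (2 * d + n) * √ε := by ring

/-- The energy `E` is `ε`-resonant for the box `S` after a suitable modification of `ω` outside of
the cube of radius `4L` about `x`. -/
def PossiblyResonant (u : Site d → ℝ) (L : ℝ) (x : Site d) (S : Finset (Site d)) (E ε : ℝ)
    (ω : Config d μ) : Prop :=
  ∃ ω' : Config d μ, (∀ k ∈ cube (4 * L) x, ω' k = ω k) ∧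
    Resonant (boxOperator (potential u ω') S) E ε

/-- The event that some energy is possibly resonant both for the box `S₁` in the cube about `x`
and for the box `S₂` in the cube about `y`. -/
def commonResonanceEvent (μ : Measure ℝ) (u : Site d → ℝ) (L ε : ℝ) (x y : Site d)
    (S₁ S₂ : Finset (Site d)) : Set (Config d μ) :=
  {ω | ∃ E, PossiblyResonant u L x S₁ E ε ω ∧ PossiblyResonant u L y S₂ E ε ω}

theorem exists_wegner [IsProbabilityMeasure μ] (hu : ExpDecay u) (hu0 : u ≠ 0)
    (hμ : Bornology.IsBounded μ.support) {V : ℝ≥0} (hV : IsTranslationLipschitz μ V) :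
    ∃ (D K c L₀ : ℝ) (p : ℕ), 0 < D ∧ 0 < K ∧ 0 < c ∧ 1 ≤ L₀ ∧ ∀ L, L₀ ≤ L → ∀ ε : ℝ,
      K * Real.exp (-c * L) ≤ ε → ε ≤ 1 / 2 →
      ∀ x y : Site d, Disjoint (cube (4 * L) x) (cube (4 * L) y) →
      ∀ S₁ ⊆ cube L x, ∀ S₂ ⊆ cube L y,
      (prob d μ).real (commonResonanceEvent μ u L ε x y S₁ S₂) ≤ D * L ^ p * √ε := by
  obtain ⟨D, L₀, p, hD, hL₀, hwegner⟩ := exists_wegner_piecewise hu hu0 hμ hV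
  obtain ⟨K, c, hK, hc, hpot⟩ := exists_abs_potential_sub_le (d := d) hu hμ
  refine ⟨D * √2, K, c, L₀, p, by positivity, hK, hc, hL₀,
    fun L hL ε hε hε1 x y hdisj S₁ hS₁ S₂ hS₂ => ?_⟩
  have hε0 : 0 < ε := lt_of_lt_of_le (by positivity) hε
  obtain ⟨ω₀⟩ : Nonempty (Config d μ) := (prob d μ).nonempty_of_neZero
  have hfreeze {w : Site d} {S : Finset (Site d)} (hS : S ⊆ cube L w) {ω : Config d μ} {E : ℝ}
      (h : PossiblyResonant u L w S E ε ω) :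
      Resonant (boxOperator (potential u ((cube (4 * L) w).piecewise ω ω₀)) S) E (2 * ε) := by
    obtain ⟨ω', hω', hres⟩ := h
    rw [two_mul]
    refine hres.change_potential hε0.le fun z hz =>
      (hpot L w ω' _ (by linarith) (fun k hk => ?_) z (hS hz)).trans hε
    rw [Finset.piecewise_eq_of_mem _ _ _ hk, hω' k hk]
  calc (prob d μ).real (commonResonanceEvent μ u L ε x y S₁ S₂)
      ≤ (prob d μ).real {ω | ∃ E,
          Resonant (boxOperator (potential u ((cube (4 * L) x).piecewise ω ω₀)) S₁) E (2 * ε) ∧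
          Resonant (boxOperator (potential u ((cube (4 * L) y).piecewise ω ω₀)) S₂) E (2 * ε)} :=
        measureReal_mono fun ω ⟨E, h₁, h₂⟩ => ⟨E, hfreeze hS₁ h₁, hfreeze hS₂ h₂⟩
    _ ≤ D * L ^ p * √(2 * ε) :=
        hwegner L hL _ (by linarith) (by linarith) x y hdisj S₁ hS₁ S₂ hS₂ ω₀
    _ = D * √2 * L ^ p * √ε := by
        rw [Real.sqrt_mul zero_le_two]
        ring

end Wegner

end AlloyMSA

/-! ### Cubes and their boundaries -/

namespace AlloyMSA

section Geometry

variable {d : ℕ}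

theorem norm1_eq_one_iff {k : Site d} :
    norm1 k = 1 ↔ ∃ (i : Fin d) (s : ℤˣ), k = Pi.single i (s : ℤ) := by
  constructor
  · intro hk
    obtain ⟨i, hi⟩ : ∃ i, k i ≠ 0 := by
      by_contra! hzero
      simp [norm1, hzero] at hk
    have hsplit : |k i| + ∑ j ∈ Finset.univ.erase i, |k j| = 1 :=
      (Finset.add_sum_erase _ (fun j => |k j|) (Finset.mem_univ i)).trans hk
    have hrest : 0 ≤ ∑ j ∈ Finset.univ.erase i, |k j| := Finset.sum_nonneg fun _ _ => abs_nonneg _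
    have hone : 1 ≤ |k i| := Int.one_le_abs hi
    have hunit : IsUnit (k i) := Int.isUnit_iff_abs_eq.2 (by lia)
    have hvanish := (Finset.sum_eq_zero_iff_of_nonneg fun j _ => abs_nonneg (k j)).1
      (show ∑ j ∈ Finset.univ.erase i, |k j| = 0 by lia)
    refine ⟨i, hunit.unit, funext fun j => ?_⟩
    rcases eq_or_ne j i with rfl | hj
    · rw [Pi.single_eq_same, IsUnit.unit_spec]
    · rw [Pi.single_eq_of_ne hj]
      exact abs_eq_zero.1 (hvanish j (Finset.mem_erase.2 ⟨hj, Finset.mem_univ j⟩))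
  · rintro ⟨i, s, rfl⟩
    rw [norm1, Finset.sum_eq_single_of_mem i (Finset.mem_univ i) fun j _ hj => by
      rw [Pi.single_eq_of_ne hj, abs_zero], Pi.single_eq_same]
    exact Int.isUnit_iff_abs_eq.1 s.isUnit

theorem card_neighbors (x : Site d) : (neighbors x).card = 2 * d := by
  have himage : neighbors x = (Finset.univ : Finset (Fin d × ℤˣ)).image
      fun p => x - Pi.single p.1 (p.2 : ℤ) := by
    ext y
    simp only [mem_neighbors, norm1_eq_one_iff, Finset.mem_image, Finset.mem_univ, true_and,
      Prod.exists]
    exact exists_congr fun i => exists_congr fun s => sub_eq_iff_comm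
  have hinj : Function.Injective fun p : Fin d × ℤˣ => x - Pi.single p.1 (p.2 : ℤ) := by
    rintro ⟨i, s⟩ ⟨j, t⟩ hst
    have hsingle : (Pi.single i (s : ℤ) : Site d) = Pi.single j (t : ℤ) :=
      sub_right_injective hst
    obtain rfl : i = j := by
      by_contra hij
      simpa [hij] using congrFun hsingle i
    rw [Units.ext (Pi.single_injective i hsingle)]
  rw [himage, Finset.card_image_of_injective _ hinj]
  simp [mul_comm]

theorem mem_innerBoundary_of_mem_neighbors {S : Finset (Site d)} {q q' : Site d} (hq : q ∈ S)
    (hq' : q' ∉ S) (h : q' ∈ neighbors q) : q ∈ innerBoundary S := by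
  refine Finset.mem_filter.2 ⟨hq, ?_⟩
  rw [← card_neighbors q]
  exact Finset.card_lt_card ⟨fun j hj => mem_neighbors.2 (Finset.mem_filter.1 hj).2,
    fun hsub => hq' (Finset.mem_filter.1 (hsub h)).1⟩

theorem mem_cube_add_one {l : ℝ} {x q q' : Site d} (hq : q ∈ cube l x) (h : q' ∈ neighbors q) :
    q' ∈ cube (l + 1) x := by
  rw [mem_cube] at hq ⊢
  intro i
  have hstep := abs_apply_le_norm1 (q - q') i
  rw [mem_neighbors.1 h, Pi.sub_apply, Int.cast_sub, Int.cast_one, abs_sub_comm] at hstep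
  linarith [abs_sub_le (q' i : ℝ) (q i) (x i), hq i]

theorem self_mem_cube {l : ℝ} (hl : 0 ≤ l) (x : Site d) : x ∈ cube l x :=
  mem_cube.2 fun i => by rwa [sub_self, abs_zero]

theorem cube_mono {l l' : ℝ} (h : l ≤ l') (x : Site d) : cube l x ⊆ cube l' x :=
  fun _ hk => mem_cube.2 fun i => (mem_cube.1 hk i).trans h

theorem mem_cube_trans {l l' : ℝ} {x z k : Site d} (hk : k ∈ cube l z) (hz : z ∈ cube l' x) :
    k ∈ cube (l' + l) x :=
  mem_cube.2 fun i => by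
    linarith [abs_sub_le (k i : ℝ) (z i) (x i), mem_cube.1 hk i, mem_cube.1 hz i]

theorem notMem_cube_of_mem_innerBoundary {L : ℝ} {x w : Site d}
    (hw : w ∈ innerBoundary (cube L x)) : w ∉ cube (L - 1) x := by
  intro hinner
  refine (Finset.mem_filter.1 hw).2.not_ge ?_
  rw [← card_neighbors w]
  refine Finset.card_le_card fun j hj => Finset.mem_filter.2 ⟨?_, mem_neighbors.1 hj⟩
  simpa only [sub_add_cancel] using mem_cube_add_one hinner hj

theorem mem_cube_iff_norm {l : ℝ} (hl : 0 ≤ l) {x z : Site d} : z ∈ cube l x ↔ ‖z - x‖ ≤ l := by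
  rw [mem_cube, pi_norm_le_iff_of_nonneg hl]
  simp only [Pi.sub_apply, Int.norm_eq_abs, Int.cast_sub]

theorem cube_natFloor {L : ℝ} (hL : 0 ≤ L) (x : Site d) : cube (⌊L⌋₊ : ℝ) x = cube L x := by
  ext k
  simp only [mem_cube, ← Int.cast_sub, ← Int.cast_abs, Int.abs_eq_natAbs, Int.cast_natCast,
    Nat.cast_le, Nat.le_floor_iff hL]

theorem card_filter_abs_sub_le (N : ℕ) (t : ℝ) {l : ℝ} (hl : 0 ≤ l) :
    (((Finset.range N).filter fun r : ℕ => |(r : ℝ) - t| ≤ l).card : ℝ) ≤ 2 * l + 1 := by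
  refine le_trans ?_ (card_Icc_ceil_floor_le t hl)
  refine Nat.cast_le.2 (Finset.card_le_card_of_injOn (fun r : ℕ => (r : ℤ)) (fun r hr => ?_)
    Nat.cast_injective.injOn)
  have hdist := abs_le.1 (Finset.mem_filter.1 hr).2
  rw [Finset.mem_coe, Finset.mem_Icc, Int.ceil_le, Int.le_floor, Int.cast_natCast]
  constructor <;> linarith

theorem card_shells_le {p : Site d → Prop} {R L : ℝ} (hR : 0 ≤ R) (hL : 0 ≤ L) {x : Site d}
    {Z : Finset (Site d)} (hp : ∀ z ∈ cube L x, p z → ∃ c ∈ Z, ‖z - c‖ ≤ R) {B : Finset ℕ}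
    (hB : ∀ r ∈ B, r < ⌊L⌋₊ ∧ ∃ z ∈ cube ((r : ℝ) + 1) x, z ∉ cube (r : ℝ) x ∧ p z) :
    (B.card : ℝ) ≤ Z.card * (2 * R + 3) := by
  have hnear : B ⊆ Z.biUnion fun c => (Finset.range ⌊L⌋₊).filter fun r : ℕ =>
      |(r : ℝ) - ‖c - x‖| ≤ R + 1 := by
    intro r hr
    obtain ⟨hrL, z, hz, hzr, hpz⟩ := hB r hr
    have hradius : (r : ℝ) + 1 ≤ L := by
      exact_mod_cast (Nat.cast_le.2 (Nat.succ_le_of_lt hrL)).trans (Nat.floor_le hL)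
    obtain ⟨c, hc, hzc⟩ := hp z (cube_mono hradius x hz) hpz
    rw [mem_cube_iff_norm (by positivity)] at hz
    rw [mem_cube_iff_norm (by positivity), not_le] at hzr
    have htriangle := abs_norm_sub_norm_le (z - x) (c - x)
    rw [sub_sub_sub_cancel_right] at htriangle
    have hdist := abs_le.1 (htriangle.trans hzc)
    refine Finset.mem_biUnion.2 ⟨c, hc, Finset.mem_filter.2 ⟨Finset.mem_range.2 hrL, ?_⟩⟩
    rw [abs_le]
    constructor <;> linarith [hdist.1, hdist.2]
  calc (B.card : ℝ) ≤ ∑ c ∈ Z, (((Finset.range ⌊L⌋₊).filter fun r : ℕ =>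
          |(r : ℝ) - ‖c - x‖| ≤ R + 1).card : ℝ) := by
        exact_mod_cast (Finset.card_le_card hnear).trans Finset.card_biUnion_le
    _ ≤ ∑ c ∈ Z, (2 * (R + 1) + 1) :=
        Finset.sum_le_sum fun c _ => card_filter_abs_sub_le _ _ (by linarith)
    _ = Z.card * (2 * R + 3) := by
        rw [Finset.sum_const, nsmul_eq_mul]
        ring

end Geometry

end AlloyMSA

/-! ### Iterating the geometric resolvent identity -/

namespace AlloyMSA

theorem eq_neg_sum_submatrix_inv_mul {ι R : Type*} [DecidableEq ι] [CommRing R]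
    (A : Matrix ι ι R) {S Λ : Finset ι} (hS : S ⊆ Λ)
    (hA : IsUnit (A.submatrix (↑) (↑) : Matrix S S R).det) {f : ι → R}
    (hf : ∀ q ∈ S, ∑ q' ∈ Λ, A q q' * f q' = 0) (z : S) :
    f z = -∑ q, (A.submatrix (↑) (↑) : Matrix S S R)⁻¹ z q * ∑ q' ∈ Λ \ S, A q q' * f q' := by
  have hmulVec : (A.submatrix (↑) (↑) : Matrix S S R).mulVec (fun q : S => f q) =
      fun q : S => -∑ q' ∈ Λ \ S, A q q' * f q' := by
    ext q
    rw [eq_neg_iff_add_eq_zero, ← hf q q.2, ← Finset.sum_sdiff hS, add_comm]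
    congr 1
    exact Finset.sum_coe_sort S fun q' => A q q' * f q'
  have hsolve : (fun q : S => f q) = (A.submatrix (↑) (↑) : Matrix S S R)⁻¹.mulVec
      fun q : S => -∑ q' ∈ Λ \ S, A q q' * f q' := by
    rw [← hmulVec, Matrix.mulVec_mulVec, Matrix.nonsing_inv_mul _ hA, Matrix.one_mulVec]
  simpa only [Matrix.mulVec, dotProduct, mul_neg, Finset.sum_neg_distrib] using congrFun hsolve z

section Resolvent

variable {d : ℕ} {v : Site d → ℝ} {S Λ : Finset (Site d)} {E : ℝ}

/-- The resolvent entries `⟨δ_x, (h - E)⁻¹ δ_y⟩` of the compression `h` of `h₀ + v` to `ℓ²(S)`, set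
to zero if `x ∉ S` or `y ∉ S`. -/
noncomputable def boxGreen (v : Site d → ℝ) (S : Finset (Site d)) (E : ℝ) (x y : Site d) : ℝ :=
  if h : x ∈ S ∧ y ∈ S then
    (boxMatrix v S - E • (1 : Matrix S S ℝ))⁻¹ ⟨x, h.1⟩ ⟨y, h.2⟩
  else 0

theorem boxGreen_coe (v : Site d → ℝ) (S : Finset (Site d)) (E : ℝ) (x y : S) :
    boxGreen v S E x y = (boxMatrix v S - E • (1 : Matrix S S ℝ))⁻¹ x y :=
  dif_pos ⟨x.2, y.2⟩

theorem boxMatrix_sub_smul_one (v : Site d → ℝ) (S : Finset (Site d)) (E : ℝ) :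
    boxMatrix v S - E • (1 : Matrix S S ℝ) =
      (latticeMatrix fun z => v z - E).submatrix (↑) (↑) := by
  have hdiag := boxMatrix_eq_add_diagonal v (fun z => v z - E) S
  simp only [sub_sub_cancel_left] at hdiag
  rw [← Matrix.diagonal_neg, ← Matrix.smul_one_eq_diagonal, ← sub_eq_add_neg] at hdiag
  exact hdiag.symm

theorem sum_latticeMatrix_mul_boxGreen (hΛ : IsUnit (boxMatrix v Λ - E • (1 : Matrix Λ Λ ℝ)).det)
    {q w : Site d} (hq : q ∈ Λ) (hw : w ∈ Λ) (hqw : q ≠ w) :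
    ∑ q' ∈ Λ, latticeMatrix (fun z => v z - E) q q' * boxGreen v Λ E q' w = 0 := by
  have hinv := congrFun (congrFun (Matrix.mul_nonsing_inv _ hΛ) ⟨q, hq⟩) ⟨w, hw⟩
  rw [Matrix.mul_apply, Matrix.one_apply_ne (by simpa using hqw)] at hinv
  rw [← hinv, ← Finset.sum_coe_sort Λ]
  refine Finset.sum_congr rfl fun q' _ => ?_
  rw [← boxGreen_coe v Λ E q' ⟨w, hw⟩, boxMatrix_sub_smul_one]
  rfl

theorem boxGreen_eq_sum (hSΛ : S ⊆ Λ)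
    (hS : IsUnit (boxMatrix v S - E • (1 : Matrix S S ℝ)).det)
    (hΛ : IsUnit (boxMatrix v Λ - E • (1 : Matrix Λ Λ ℝ)).det) {z w : Site d} (hz : z ∈ S)
    (hw : w ∈ Λ) (hwS : w ∉ S) :
    boxGreen v Λ E z w = ∑ q ∈ S, boxGreen v S E z q *
      ∑ q' ∈ neighbors q ∩ (Λ \ S), boxGreen v Λ E q' w := by
  have hsolve := eq_neg_sum_submatrix_inv_mul (latticeMatrix fun z => v z - E) hSΛ
    (by rwa [boxMatrix_sub_smul_one] at hS) (fun q hq => sum_latticeMatrix_mul_boxGreen hΛ (hSΛ hq)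
      hw (ne_of_mem_of_not_mem hq hwS)) ⟨z, hz⟩
  rw [hsolve, ← Finset.sum_coe_sort S, ← Finset.sum_neg_distrib]
  refine Finset.sum_congr rfl fun q _ => ?_
  rw [boxGreen_coe v S E ⟨z, hz⟩ q, boxMatrix_sub_smul_one, ← mul_neg, ← Finset.sum_neg_distrib,
    Finset.inter_comm, ← Finset.filter_mem_eq_inter, Finset.sum_filter]
  congr 1
  refine Finset.sum_congr rfl fun q' hq' => ?_
  rw [latticeMatrix_apply_of_ne _ (ne_of_mem_of_not_mem q.2 (Finset.mem_sdiff.1 hq').2)]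
  simp only [mem_neighbors]
  split_ifs <;> simp

/-- `E` is not an eigenvalue of the compression of `h₀ + v` to `ℓ²(S)`, and its resolvent is
bounded by `b` from `z` to the interior boundary of `S`. -/
def HasGreenBound (v : Site d → ℝ) (S : Finset (Site d)) (E : ℝ) (z : Site d) (b : ℝ) : Prop :=
  IsUnit (boxMatrix v S - E • (1 : Matrix S S ℝ)).det ∧
    ∀ w ∈ innerBoundary S, |boxGreen v S E z w| ≤ b

theorem isRegular_iff_hasGreenBound {μ : Measure ℝ} {u : Site d → ℝ} {l m : ℝ} {x : Site d}
    {ω : Config d μ} :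
    IsRegular u l x m E ω ↔
      HasGreenBound (potential u ω) (cube l x) E x (Real.exp (-(m * l))) :=
  and_congr notMem_spectrum_iff_isUnit_det Iff.rfl

theorem abs_boxGreen_le_of_not_resonant {ε : ℝ} (hε : 0 < ε)
    (h : ¬ Resonant (boxOperator v S) E ε) (x y : Site d) : |boxGreen v S E x y| ≤ 1 / ε := by
  rw [boxGreen]
  split_ifs with hxy
  · exact abs_inv_apply_le_of_not_resonant hε h _ _
  · rw [abs_zero]
    positivity

theorem hasGreenBound_of_not_resonant {ε : ℝ} (hε : 0 < ε)
    (h : ¬ Resonant (boxOperator v S) E ε) (z : Site d) : HasGreenBound v S E z (1 / ε) :=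
  ⟨isUnit_det_of_not_resonant hε.le h, fun _ _ => abs_boxGreen_le_of_not_resonant hε h _ _⟩

theorem HasGreenBound.abs_boxGreen_le {z w : Site d} {b M : ℝ} (hS : HasGreenBound v S E z b)
    (hSΛ : S ⊆ Λ) (hΛ : IsUnit (boxMatrix v Λ - E • (1 : Matrix Λ Λ ℝ)).det) (hz : z ∈ S)
    (hw : w ∈ Λ) (hwS : w ∉ S) (hb : 0 ≤ b) (hM : 0 ≤ M)
    (houter : ∀ q ∈ S, ∀ q' ∈ neighbors q, q' ∉ S → |boxGreen v Λ E q' w| ≤ M) :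
    |boxGreen v Λ E z w| ≤ S.card * (2 * d) * (b * M) := by
  have hterm (q : Site d) (hq : q ∈ S) : |boxGreen v S E z q *
      ∑ q' ∈ neighbors q ∩ (Λ \ S), boxGreen v Λ E q' w| ≤ b * (2 * d * M) := by
    rcases (neighbors q ∩ (Λ \ S)).eq_empty_or_nonempty with hempty | ⟨q', hq'⟩
    · rw [hempty, Finset.sum_empty, mul_zero, abs_zero]
      positivity
    have hboundary : q ∈ innerBoundary S := by
      simp only [Finset.mem_inter, Finset.mem_sdiff] at hq'
      exact mem_innerBoundary_of_mem_neighbors hq hq'.2.2 hq'.1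
    have hcard : ((neighbors q ∩ (Λ \ S)).card : ℝ) ≤ 2 * d := by
      exact_mod_cast (Finset.card_le_card Finset.inter_subset_left).trans_eq (card_neighbors q)
    have hsum : |∑ q' ∈ neighbors q ∩ (Λ \ S), boxGreen v Λ E q' w| ≤ 2 * d * M :=
      calc |∑ q' ∈ neighbors q ∩ (Λ \ S), boxGreen v Λ E q' w|
          ≤ ∑ q' ∈ neighbors q ∩ (Λ \ S), |boxGreen v Λ E q' w| := Finset.abs_sum_le_sum_abs _ _
        _ ≤ (neighbors q ∩ (Λ \ S)).card • M := Finset.sum_le_card_nsmul _ _ _ fun q' hq' => by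
            simp only [Finset.mem_inter, Finset.mem_sdiff] at hq'
            exact houter q hq q' hq'.1 hq'.2.2
        _ ≤ 2 * d * M := by
            rw [nsmul_eq_mul]
            gcongr
    rw [abs_mul]
    exact mul_le_mul (hS.2 q hboundary) hsum (abs_nonneg _) hb
  rw [boxGreen_eq_sum hSΛ hS.1 hΛ hz hw hwS]
  calc _ ≤ S.card • (b * (2 * d * M)) :=
        (Finset.abs_sum_le_sum_abs _ _).trans (Finset.sum_le_card_nsmul _ _ _ hterm)
    _ = S.card * (2 * d) * (b * M) := by
        rw [nsmul_eq_mul]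
        ring

-- The resolvent identity is applied twice: first in the non-resonant cube of radius `r`, then in
-- the regular cubes of radius `l` centered just outside of it.
theorem abs_boxGreen_le_of_surrounded {ε l b M L r s : ℝ} (hε : 0 < ε) (hl : 1 ≤ l) (hb : 0 ≤ b)
    (hM : 0 ≤ M) {x w : Site d} (hr : 0 ≤ r) (hs : l + 2 ≤ s) (hrs : r + s ≤ L)
    (hcore : ¬ Resonant (boxOperator v (cube r x)) E ε)
    (hΛ : IsUnit (boxMatrix v (cube L x) - E • (1 : Matrix (cube L x) (cube L x) ℝ)).det)
    (hshell : ∀ z ∈ cube (r + 1) x, z ∉ cube r x → HasGreenBound v (cube l z) E z b)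
    (hw : w ∈ innerBoundary (cube L x))
    (hmax : ∀ q ∈ cube (r + s) x, |boxGreen v (cube L x) E q w| ≤ M) {z : Site d}
    (hz : z ∈ cube r x) :
    |boxGreen v (cube L x) E z w| ≤ (2 * d * (3 * L) ^ d) ^ 2 * b / ε * M := by
  have hwΛ : w ∈ cube L x := (Finset.mem_filter.1 hw).1
  have hw_out {T : Finset (Site d)} (hT : T ⊆ cube (L - 1) x) : w ∉ T :=
    fun h => notMem_cube_of_mem_innerBoundary hw (hT h)
  have hinner : cube (L - 1) x ⊆ cube L x := cube_mono (by linarith) x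
  have houter : ∀ q ∈ cube (r + 1) x, q ∉ cube r x →
      |boxGreen v (cube L x) E q w| ≤ (3 * L) ^ d * (2 * d) * (b * M) := by
    intro q hq hqr
    have hsub : cube l q ⊆ cube (L - 1) x := fun k hk =>
      cube_mono (by linarith) x (mem_cube_trans hk hq)
    refine ((hshell q hq hqr).abs_boxGreen_le (hsub.trans hinner) hΛ
      (self_mem_cube (by linarith) q) hwΛ (hw_out hsub) hb hM fun y hy y' hy' _ => hmax y'
        (cube_mono (by linarith) x (mem_cube_trans (mem_cube_add_one hy hy') hq))).trans ?_
    gcongr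
    exact card_le_of_subset_cube (by linarith) (by linarith) (by linarith) subset_rfl
  have hsub : cube r x ⊆ cube (L - 1) x := cube_mono (by linarith) x
  have hL : 0 ≤ L := by linarith
  calc |boxGreen v (cube L x) E z w|
      ≤ (cube r x).card * (2 * d) * (1 / ε * ((3 * L) ^ d * (2 * d) * (b * M))) :=
        (hasGreenBound_of_not_resonant hε hcore z).abs_boxGreen_le (hsub.trans hinner) hΛ hz hwΛ
          (hw_out hsub) (by positivity) (by positivity)
          fun q hq q' hq' hq'r => houter q' (mem_cube_add_one hq hq') hq'r
    _ ≤ (3 * L) ^ d * (2 * d) * (1 / ε * ((3 * L) ^ d * (2 * d) * (b * M))) := by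
        gcongr
        exact card_le_of_subset_cube hr (by linarith) (by linarith) subset_rfl
    _ = (2 * d * (3 * L) ^ d) ^ 2 * b / ε * M := by ring

end Resolvent

theorem iterate_step_outside_finset {P : ℕ → ℕ → Prop} {B : Finset ℕ} {N s : ℕ} (hs : 0 < s)
    (hanti : ∀ {r r'} k, r ≤ r' → P r' k → P r k) (hstart : P N 0)
    (hstep : ∀ {r k}, r ∉ B → r + s ≤ N → P (r + s) k → P r (k + 1)) (n r : ℕ)
    (hn : r + n * s + (B.filter fun q => r ≤ q).card ≤ N) : P r n := by
  obtain _ | n := n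
  · exact hanti 0 (by lia) hstart
  by_cases hr : r ∈ B
  · have hcard : (B.filter fun q => r + 1 ≤ q).card < (B.filter fun q => r ≤ q).card :=
      Finset.card_lt_card <| Finset.ssubset_iff_of_subset
        (Finset.monotone_filter_right B fun q _ hq => Nat.le_of_succ_le hq) |>.2
        ⟨r, by simp [hr]⟩
    exact hanti _ (Nat.le_succ r) (iterate_step_outside_finset hs hanti hstart hstep (n + 1) (r + 1)
      (by lia))
  · rw [Nat.succ_mul] at hn
    have hcard : (B.filter fun q => r + s ≤ q).card ≤ (B.filter fun q => r ≤ q).card :=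
      Finset.card_le_card (Finset.monotone_filter_right B fun q _ hq => by lia)
    exact hstep hr (by lia) (iterate_step_outside_finset hs hanti hstart hstep n (r + s) (by lia))
termination_by N - r
decreasing_by all_goals lia

section Iteration

variable {d : ℕ} {v : Site d → ℝ} {E : ℝ}

theorem hasGreenBound_of_regular_shells {ε l b L : ℝ} {s : ℕ} (hε : 0 < ε) (hl : 1 ≤ l)
    (hb : 0 ≤ b) (hL : 0 ≤ L) (hs : l + 2 ≤ s) {x : Site d}
    (hres : ∀ r : ℕ, r ≤ ⌊L⌋₊ → ¬ Resonant (boxOperator v (cube r x)) E ε) {B : Finset ℕ}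
    (hshell : ∀ r : ℕ, r < ⌊L⌋₊ → r ∉ B → ∀ z ∈ cube ((r : ℝ) + 1) x, z ∉ cube (r : ℝ) x →
      HasGreenBound v (cube l z) E z b) {n : ℕ} (hn : n * s + B.card ≤ ⌊L⌋₊) :
    HasGreenBound v (cube L x) E x (((2 * d * (3 * L) ^ d) ^ 2 * b / ε) ^ n * (1 / ε)) := by
  have hresL : ¬ Resonant (boxOperator v (cube L x)) E ε := by
    rw [← cube_natFloor hL]
    exact hres _ le_rfl
  have hdet := isUnit_det_of_not_resonant hε.le hresL
  have hs0 : 0 < s := Nat.cast_pos (α := ℝ) |>.1 (by linarith)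
  refine ⟨hdet, fun w hw => ?_⟩
  have hcard : (B.filter fun q => 0 ≤ q).card ≤ B.card := Finset.card_filter_le _ _
  refine iterate_step_outside_finset (B := B) (N := ⌊L⌋₊) (s := s)
    (P := fun r k => ∀ q ∈ cube (r : ℝ) x, |boxGreen v (cube L x) E q w| ≤
      ((2 * d * (3 * L) ^ d) ^ 2 * b / ε) ^ k * (1 / ε))
    hs0 (fun k hrr' h q hq => h q (cube_mono (Nat.cast_le.2 hrr') x hq))
    (fun q _ => by simpa using abs_boxGreen_le_of_not_resonant hε hresL q w)
    (fun {r k} hrB hrs hmax q hq => ?_) n 0 (by lia) x (self_mem_cube (Nat.cast_nonneg _) x)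
  have hrL : (r : ℝ) + s ≤ L := by exact_mod_cast (Nat.cast_le.2 hrs).trans (Nat.floor_le hL)
  rw [pow_succ', mul_assoc]
  exact abs_boxGreen_le_of_surrounded hε hl hb (by positivity) r.cast_nonneg hs hrL
    (hres r (by lia)) hdet (hshell r (by lia) hrB) hw (by exact_mod_cast hmax) hq

theorem hasGreenBound_of_regular_subcubes {ε l b R L : ℝ} (hε : 0 < ε) (hl : 1 ≤ l) (hb : 0 ≤ b)
    (hR : 0 ≤ R) {x : Site d}
    (hres : ∀ r : ℕ, r ≤ ⌊L⌋₊ → ¬ Resonant (boxOperator v (cube r x)) E ε) {Z : Finset (Site d)}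
    (hreg : ∀ z ∈ cube L x, (∀ c ∈ Z, R < ‖z - c‖) → HasGreenBound v (cube l z) E z b) {n : ℕ}
    (hn : n * (l + 3) + Z.card * (2 * R + 3) + 1 ≤ L) :
    HasGreenBound v (cube L x) E x (((2 * d * (3 * L) ^ d) ^ 2 * b / ε) ^ n * (1 / ε)) := by
  classical
  have hL : 0 ≤ L := le_trans (by positivity) hn
  let badShell (r : ℕ) : Prop :=
    ∃ z ∈ cube ((r : ℝ) + 1) x, z ∉ cube (r : ℝ) x ∧ ¬ HasGreenBound v (cube l z) E z b
  have hcard : (((Finset.range ⌊L⌋₊).filter badShell).card : ℝ) ≤ Z.card * (2 * R + 3) := by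
    refine card_shells_le (x := x) (p := fun z => ¬ HasGreenBound v (cube l z) E z b) hR hL
      (fun z hz hbad => ?_) fun r hr => ?_
    · by_contra! hfar
      exact hbad (hreg z hz hfar)
    · rwa [Finset.mem_filter, Finset.mem_range] at hr
  have hstep : ((⌈l⌉₊ + 2 : ℕ) : ℝ) ≤ l + 3 := by
    push_cast
    linarith [Nat.ceil_lt_add_one (zero_le_one.trans hl)]
  refine hasGreenBound_of_regular_shells (s := ⌈l⌉₊ + 2) (B := (Finset.range ⌊L⌋₊).filter badShell)
    hε hl hb hL ?_ hres (fun r hr hrB z hz hzr => ?_) (Nat.le_floor ?_)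
  · push_cast
    linarith [Nat.le_ceil l]
  · by_contra hbad
    exact hrB (Finset.mem_filter.2 ⟨Finset.mem_range.2 hr, z, hz, hzr, hbad⟩)
  · rw [Nat.cast_add, Nat.cast_mul]
    linarith [mul_le_mul_of_nonneg_left hstep n.cast_nonneg]

end Iteration

end AlloyMSA

/-! ### Measurability and independence of the bad events -/

namespace AlloyMSA

section SigmaCompact

variable {X Y : Type*} [TopologicalSpace X] [TopologicalSpace Y]

theorem isSigmaCompact_union {s t : Set X} (hs : IsSigmaCompact s) (ht : IsSigmaCompact t) :
    IsSigmaCompact (s ∪ t) := by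
  rw [union_eq_iUnion]
  exact isSigmaCompact_iUnion _ (Bool.rec ht hs)

theorem isSigmaCompact_inter [T2Space X] {s t : Set X} (hs : IsSigmaCompact s)
    (ht : IsSigmaCompact t) : IsSigmaCompact (s ∩ t) := by
  obtain ⟨K, hK, rfl⟩ := hs
  obtain ⟨K', hK', rfl⟩ := ht
  rw [iUnion_inter_iUnion]
  exact isSigmaCompact_iUnion _ fun i => isSigmaCompact_iUnion_of_isCompact _ fun j =>
    (hK i).inter (hK' j)

theorem isSigmaCompact_preimage [SigmaCompactSpace X] [T2Space Y] {f : X → Y} (hf : Continuous f)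
    {s : Set Y} (hs : IsSigmaCompact s) : IsSigmaCompact (f ⁻¹' s) := by
  obtain ⟨K, hK, rfl⟩ := hs
  rw [preimage_iUnion]
  exact isSigmaCompact_iUnion _ fun n =>
    isSigmaCompact_of_isClosed ((hK n).isClosed.preimage hf)

theorem isSigmaCompact_of_isOpen {Z : Type*} [PseudoEMetricSpace Z] [SigmaCompactSpace Z]
    {s : Set Z} (h : IsOpen s) : IsSigmaCompact s := by
  obtain ⟨F, hF, -, rfl, -⟩ := h.exists_iUnion_isClosed
  exact isSigmaCompact_iUnion _ fun n => isSigmaCompact_of_isClosed (hF n)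

theorem isSigmaCompact_lt [SigmaCompactSpace X] {f g : X → ℝ} (hf : Continuous f)
    (hg : Continuous g) : IsSigmaCompact {x | f x < g x} :=
  isSigmaCompact_preimage (s := {p : ℝ × ℝ | p.1 < p.2}) (hf.prodMk hg)
    (isSigmaCompact_of_isOpen isOpen_lt_prod)

theorem isSigmaCompact_of_ordConnected {I : Set ℝ} (hI : I.OrdConnected) : IsSigmaCompact I := by
  have hIcc (a b : ℝ) := isSigmaCompact_of_isClosed (isClosed_Icc (a := a) (b := b))
  have hIci (a : ℝ) := isSigmaCompact_of_isClosed (isClosed_Ici (a := a))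
  have hIic (a : ℝ) := isSigmaCompact_of_isClosed (isClosed_Iic (a := a))
  have hIoo (a b : ℝ) := isSigmaCompact_of_isOpen (isOpen_Ioo (a := a) (b := b))
  have hIoi (a : ℝ) := isSigmaCompact_of_isOpen (isOpen_Ioi (a := a))
  have hIio (a : ℝ) := isSigmaCompact_of_isOpen (isOpen_Iio (a := a))
  have hintervals := hI.isPreconnected.mem_intervals
  simp only [mem_insert_iff, mem_singleton_iff] at hintervals
  rcases hintervals with h | h | h | h | h | h | h | h | h | h <;> rw [h]
  · exact hIcc _ _
  · exact isSigmaCompact_inter (hIci _) (hIio _)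
  · exact isSigmaCompact_inter (hIoi _) (hIic _)
  · exact hIoo _ _
  · exact hIci _
  · exact hIoi _
  · exact hIic _
  · exact hIio _
  · exact isSigmaCompact_univ
  · exact isSigmaCompact_empty

end SigmaCompact

section Measurability

variable {d : ℕ} {μ : Measure ℝ} {u : Site d → ℝ}

theorem hasGreenBound_iff_adjugate {v : Site d → ℝ} {S : Finset (Site d)} {E b : ℝ} {z : S} :
    HasGreenBound v S E z b ↔ (boxMatrix v S - E • (1 : Matrix S S ℝ)).det ≠ 0 ∧
      ∀ w : S, (w : Site d) ∈ innerBoundary S →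
        |(boxMatrix v S - E • (1 : Matrix S S ℝ)).adjugate z w| ≤
          b * |(boxMatrix v S - E • (1 : Matrix S S ℝ)).det| := by
  refine (and_congr_left' isUnit_iff_ne_zero).trans (and_congr_right fun hdet => ?_)
  have hcramer (w : S) : |boxGreen v S E z w| ≤ b ↔
      |(boxMatrix v S - E • (1 : Matrix S S ℝ)).adjugate z w| ≤
        b * |(boxMatrix v S - E • (1 : Matrix S S ℝ)).det| := by
    rw [boxGreen_coe, Matrix.inv_def, Matrix.smul_apply, Ring.inverse_eq_inv, smul_eq_mul,
      abs_mul, abs_inv, inv_mul_le_iff₀ (abs_pos.2 hdet), mul_comm]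
  exact ⟨fun h w hw => (hcramer w).1 (h w hw),
    fun h w hw => (hcramer ⟨w, (Finset.mem_filter.1 hw).1⟩).2 (h _ hw)⟩

theorem isSigmaCompact_not_hasGreenBound {X : Type*} [TopologicalSpace X] [SigmaCompactSpace X]
    {v : X → Site d → ℝ} (hv : ∀ z, Continuous fun x => v x z) {S : Finset (Site d)} {z : Site d}
    (hz : z ∈ S) (b : ℝ) :
    IsSigmaCompact {p : ℝ × X | ¬ HasGreenBound (v p.2) S p.1 z b} := by
  let A (p : ℝ × X) : Matrix S S ℝ := boxMatrix (v p.2) S - p.1 • (1 : Matrix S S ℝ)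
  have hA : Continuous A :=
    ((continuous_boxMatrix hv S).comp continuous_snd).sub (continuous_fst.smul continuous_const)
  have hcompl : {p : ℝ × X | ¬ HasGreenBound (v p.2) S p.1 z b} =
      {p | (A p).det = 0} ∪ ⋃ w : {w : S // (w : Site d) ∈ innerBoundary S},
        {p | b * |(A p).det| < |(A p).adjugate ⟨z, hz⟩ w|} := by
    ext p
    have hiff := hasGreenBound_iff_adjugate (v := v p.2) (E := p.1) (b := b) (z := ⟨z, hz⟩)
    simp only [mem_ofPred_eq, hiff, not_and_or, not_not, not_forall, not_le, mem_union,
      mem_iUnion, Subtype.exists, exists_prop, A]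
  rw [hcompl]
  exact isSigmaCompact_union
    (isSigmaCompact_of_isClosed (isClosed_eq hA.matrix_det continuous_const))
    (isSigmaCompact_iUnion _ fun w => isSigmaCompact_lt (continuous_const.mul hA.matrix_det.abs)
      (hA.matrix_adjugate.matrix_elem _ _).abs)

theorem compactSpace_support (hμ : Bornology.IsBounded μ.support) : CompactSpace μ.support :=
  isCompact_iff_compactSpace.1
    (Metric.isCompact_of_isClosed_isBounded Measure.isClosed_support hμ)

theorem continuous_potential (hu : ExpDecay u) (hμ : Bornology.IsBounded μ.support) (x : Site d) :
    Continuous fun ω : Config d μ => potential u ω x := by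
  obtain ⟨R, -, hR⟩ := exists_bound_support hμ
  have hsum : Summable fun k => |u (x - k)| := (Equiv.subLeft x).summable_iff.2 hu.summable_abs
  refine continuous_tsum (fun k => by fun_prop) (hsum.mul_left R) fun k ω => ?_
  rw [norm_mul]
  exact mul_le_mul_of_nonneg_right (hR (ω k)) (norm_nonneg _)

-- The set is a projection of a `σ`-compact set along the configurations agreeing on the cube.
theorem isSigmaCompact_not_isUnifRegular (hu : ExpDecay u) (hμ : Bornology.IsBounded μ.support)
    {l : ℝ} (hl : 0 ≤ l) (z : Site d) (m : ℝ) :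
    IsSigmaCompact {p : ℝ × Config d μ | ¬ IsUnifRegular u l z m p.1 p.2} := by
  have := compactSpace_support hμ
  have hregular := isSigmaCompact_not_hasGreenBound (continuous_potential hu hμ)
    (self_mem_cube hl z) (Real.exp (-(m * l)))
  have hagree : IsClosed {p : ℝ × Config d μ × Config d μ |
      ∀ k ∈ cube (4 * l) z, p.2.2 k = p.2.1 k} := by
    simp only [ofPred_forall]
    exact isClosed_biInter fun k _ => isClosed_eq (by fun_prop) (by fun_prop)
  convert (isSigmaCompact_inter (isSigmaCompact_of_isClosed hagree)
    (isSigmaCompact_preimage (f := fun p => (p.1, p.2.2)) (by fun_prop) hregular)).image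
      (f := fun p => (p.1, p.2.1)) (by fun_prop) using 1
  ext ⟨E, ω⟩
  simp only [IsUnifRegular, isRegular_iff_hasGreenBound, not_forall, mem_ofPred_eq, mem_image,
    mem_inter_iff, mem_preimage, Prod.exists, Prod.mk.injEq, exists_prop]
  exact ⟨fun ⟨ω', h⟩ => ⟨E, ω, ω', h, rfl, rfl⟩, by
    rintro ⟨_, _, ω', h, rfl, rfl⟩
    exact ⟨ω', h⟩⟩

theorem measurableSet_badEvent (hu : ExpDecay u) (hμ : Bornology.IsBounded μ.support) {l : ℝ}
    (hl : 0 ≤ l) (z₁ z₂ : Site d) (m : ℝ) {I : Set ℝ} (hI : IsSigmaCompact I) :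
    MeasurableSet (badEvent μ u l z₁ z₂ m I) := by
  have := compactSpace_support hμ
  refine measurableSet_of_isSigmaCompact ?_
  convert (isSigmaCompact_inter (isSigmaCompact_preimage continuous_fst hI)
    (isSigmaCompact_inter (isSigmaCompact_not_isUnifRegular hu hμ hl z₁ m)
      (isSigmaCompact_not_isUnifRegular hu hμ hl z₂ m))).image continuous_snd using 1
  ext ω
  simp [badEvent]

end Measurability

section Independence

open ProbabilityTheory

variable {ι : Type*} {Ω : ι → Type*} [∀ i, MeasurableSpace (Ω i)]

theorem exists_eq_preimage_restrict_of_dependsOn {A : Set (∀ i, Ω i)} {T : Finset ι}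
    (h : DependsOn (· ∈ A) T) (hA : MeasurableSet A) (ω₀ : ∀ i, Ω i) :
    ∃ B : Set (∀ i : T, Ω i), MeasurableSet B ∧ A = T.restrict ⁻¹' B := by
  classical
  refine ⟨Function.updateFinset ω₀ T ⁻¹' A, measurable_updateFinset hA, ?_⟩
  ext ω
  exact (h fun i hi => by simp [Function.updateFinset, Finset.mem_coe.1 hi]).to_iff

theorem infinitePi_real_inter_eq_mul (P : ∀ i, Measure (Ω i)) [∀ i, IsProbabilityMeasure (P i)]
    {A A' : Set (∀ i, Ω i)} {T T' : Finset ι} (hT : Disjoint T T') (h : DependsOn (· ∈ A) T)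
    (h' : DependsOn (· ∈ A') T') (hA : MeasurableSet A) (hA' : MeasurableSet A') :
    (Measure.infinitePi P).real (A ∩ A') =
      (Measure.infinitePi P).real A * (Measure.infinitePi P).real A' := by
  obtain ⟨ω₀⟩ : Nonempty (∀ i, Ω i) := (Measure.infinitePi P).nonempty_of_neZero
  obtain ⟨B, hB, rfl⟩ := exists_eq_preimage_restrict_of_dependsOn h hA ω₀
  obtain ⟨B', hB', rfl⟩ := exists_eq_preimage_restrict_of_dependsOn h' hA' ω₀
  have hindep : iIndepFun (fun i (ω : ∀ i, Ω i) => ω i) (Measure.infinitePi P) :=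
    iIndepFun_infinitePi (X := fun _ => id) fun _ => measurable_id
  have hmul := (hindep.indepFun_finset T T' hT measurable_pi_apply).measure_inter_preimage_eq_mul
    B B' hB hB'
  simp only [Measure.real, ← ENNReal.toReal_mul]
  exact congrArg ENNReal.toReal hmul

end Independence

section FourBadCubes

variable {d : ℕ} {μ : Measure ℝ} {u : Site d → ℝ} {l L m ξ : ℝ} {I : Set ℝ}

theorem isUnifRegular_congr {z : Site d} {E : ℝ} {ω ω' : Config d μ}
    (h : ∀ k ∈ cube (4 * l) z, ω k = ω' k) :
    IsUnifRegular u l z m E ω ↔ IsUnifRegular u l z m E ω' :=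
  forall_congr' fun _ => imp_congr_left <| forall₂_congr fun k hk => by rw [h k hk]

theorem dependsOn_badEvent [DecidableEq (Site d)] (z₁ z₂ : Site d) :
    DependsOn (· ∈ badEvent μ u l z₁ z₂ m I) ↑(cube (4 * l) z₁ ∪ cube (4 * l) z₂) := by
  intro ω ω' h
  have h₁ (E : ℝ) := isUnifRegular_congr (u := u) (m := m) (E := E) fun k hk =>
    h k (Finset.mem_union_left (cube (4 * l) z₂) hk)
  have h₂ (E : ℝ) := isUnifRegular_congr (u := u) (m := m) (E := E) fun k hk =>
    h k (Finset.mem_union_right (cube (4 * l) z₁) hk)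
  simp only [badEvent, mem_ofPred_eq, h₁, h₂]

theorem disjoint_cube_of_lt (hl : 0 ≤ l) {x y : Site d} (h : 8 * l < ‖x - y‖) :
    Disjoint (cube (4 * l) x) (cube (4 * l) y) := by
  refine Finset.disjoint_left.2 fun k hx hy => ?_
  rw [mem_cube_iff_norm (by linarith)] at hx hy
  have htriangle := norm_sub_le (k - y) (k - x)
  rw [sub_sub_sub_cancel_left] at htriangle
  linarith

/-- Four cubes of radius `l` with distant centers in the cube of radius `L` about `x` fail to be
uniformly regular for a common energy. -/
def fourBadEvent (μ : Measure ℝ) (u : Site d → ℝ) (l L : ℝ) (x : Site d) (m : ℝ) (I : Set ℝ) :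
    Set (Config d μ) :=
  {ω | ∃ E ∈ I, ∃ z : Fin 4 → Site d, (∀ i, z i ∈ cube L x) ∧
    (Pairwise fun i j => 8 * l < ‖z i - z j‖) ∧ ∀ i, ¬ IsUnifRegular u l (z i) m E ω}

theorem GEstimate.measureReal_badEvent_le [IsProbabilityMeasure μ]
    (hG : GEstimate μ u I l m ξ) (hu : ExpDecay u) (hμ : Bornology.IsBounded μ.support)
    (hI : IsSigmaCompact I) (hl : 0 ≤ l) {z₁ z₂ : Site d} (hz : 8 * l < ‖z₁ - z₂‖) :
    (prob d μ).real (badEvent μ u l z₁ z₂ m I) ≤ l ^ (-(2 * ξ)) := by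
  have h := hG z₁ z₂ hz
  rw [probReal_compl_eq_one_sub (measurableSet_badEvent hu hμ hl z₁ z₂ m hI)] at h
  linarith

theorem GEstimate.measureReal_badEvent_inter_le [IsProbabilityMeasure μ]
    (hG : GEstimate μ u I l m ξ) (hu : ExpDecay u) (hμ : Bornology.IsBounded μ.support)
    (hI : IsSigmaCompact I) (hl : 0 ≤ l) {z : Fin 4 → Site d}
    (hz : Pairwise fun i j => 8 * l < ‖z i - z j‖) :
    (prob d μ).real (badEvent μ u l (z 0) (z 1) m I ∩ badEvent μ u l (z 2) (z 3) m I) ≤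
      (l ^ (-(2 * ξ))) ^ 2 := by
  classical
  have hdisj {i j : Fin 4} (hij : i ≠ j) :
      Disjoint (cube (4 * l) (z i)) (cube (4 * l) (z j)) := disjoint_cube_of_lt hl (hz hij)
  have hunions : Disjoint (cube (4 * l) (z 0) ∪ cube (4 * l) (z 1))
      (cube (4 * l) (z 2) ∪ cube (4 * l) (z 3)) := by
    rw [Finset.disjoint_union_left, Finset.disjoint_union_right, Finset.disjoint_union_right]
    exact ⟨⟨hdisj (by decide), hdisj (by decide)⟩, hdisj (by decide), hdisj (by decide)⟩
  rw [sq, prob, infinitePi_real_inter_eq_mul _ hunions (dependsOn_badEvent _ _)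
    (dependsOn_badEvent _ _) (measurableSet_badEvent hu hμ hl _ _ m hI)
    (measurableSet_badEvent hu hμ hl _ _ m hI)]
  exact mul_le_mul (hG.measureReal_badEvent_le hu hμ hI hl (hz (by decide)))
    (hG.measureReal_badEvent_le hu hμ hI hl (hz (by decide))) measureReal_nonneg
    (Real.rpow_nonneg hl _)

theorem GEstimate.measureReal_fourBadEvent_le [IsProbabilityMeasure μ]
    (hG : GEstimate μ u I l m ξ) (hu : ExpDecay u) (hμ : Bornology.IsBounded μ.support)
    (hI : IsSigmaCompact I) (hl : 0 ≤ l) (x : Site d) :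
    (prob d μ).real (fourBadEvent μ u l L x m I) ≤
      ((cube L x).card : ℝ) ^ 4 * (l ^ (-(2 * ξ))) ^ 2 := by
  classical
  let Q : Finset (Fin 4 → Site d) := (Fintype.piFinset fun _ => cube L x).filter
    fun z => Pairwise fun i j => 8 * l < ‖z i - z j‖
  let twoPairs (z : Fin 4 → Site d) : Set (Config d μ) :=
    badEvent μ u l (z 0) (z 1) m I ∩ badEvent μ u l (z 2) (z 3) m I
  have hsub : fourBadEvent μ u l L x m I ⊆ ⋃ z ∈ Q, twoPairs z := by
    rintro ω ⟨E, hE, z, hz, hfar, hbad⟩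
    exact mem_biUnion (x := z) (Finset.mem_filter.2 ⟨Fintype.mem_piFinset.2 hz, hfar⟩)
      ⟨⟨E, hE, hbad 0, hbad 1⟩, E, hE, hbad 2, hbad 3⟩
  have hcard : Q.card ≤ (cube L x).card ^ 4 := (Finset.card_filter_le _ _).trans (by simp)
  calc (prob d μ).real (fourBadEvent μ u l L x m I)
      ≤ (prob d μ).real (⋃ z ∈ Q, twoPairs z) := measureReal_mono hsub (measure_ne_top _ _)
    _ ≤ ∑ z ∈ Q, (prob d μ).real (twoPairs z) := measureReal_biUnion_finset_le _ _
    _ ≤ Q.card • (l ^ (-(2 * ξ))) ^ 2 := Finset.sum_le_card_nsmul _ _ _ fun z hz =>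
        hG.measureReal_badEvent_inter_le hu hμ hI hl (Finset.mem_filter.1 hz).2
    _ ≤ ((cube L x).card : ℝ) ^ 4 * (l ^ (-(2 * ξ))) ^ 2 := by
        rw [nsmul_eq_mul]
        gcongr
        exact_mod_cast hcard

end FourBadCubes

theorem exists_finset_of_not_exists_pairwise {X : Type*} {S : Set X} {far : X → X → Prop}
    (hsymm : ∀ {a b}, far a b → far b a) (n : ℕ)
    (h : ¬ ∃ z : Fin (n + 1) → X, (∀ i, z i ∈ S) ∧ Pairwise fun i j => far (z i) (z j)) :
    ∃ C : Finset X, C.card ≤ n ∧ ∀ z ∈ S, ∃ c ∈ C, ¬ far z c := by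
  classical
  induction n with
  | zero =>
    exact ⟨∅, le_rfl, fun z hz => (h ⟨fun _ => z, fun _ => hz,
      Subsingleton.pairwise (α := Fin 1)⟩).elim⟩
  | succ n ih =>
    by_cases hn : ∃ z : Fin (n + 1) → X, (∀ i, z i ∈ S) ∧ Pairwise fun i j => far (z i) (z j)
    · obtain ⟨z, hz, hfar⟩ := hn
      refine ⟨Finset.univ.image z, Finset.card_image_le.trans (by simp), fun a ha => ?_⟩
      by_contra! hsep
      have hsep' (i : Fin (n + 1)) : far a (z i) :=
        hsep (z i) (Finset.mem_image_of_mem z (Finset.mem_univ i))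
      refine h ⟨Fin.cons a z, Fin.cases ha hz, ?_⟩
      refine Fin.cases (Fin.cases (fun hne => (hne rfl).elim) fun j _ => hsep' j) fun i =>
        Fin.cases (fun _ => hsymm (hsep' i)) fun j hne => hfar (mt (congrArg Fin.succ) hne)
    · obtain ⟨C, hC, hcover⟩ := ih hn
      exact ⟨C, hC.trans n.le_succ, hcover⟩

end AlloyMSA

/-! ### The induction step -/

namespace AlloyMSA

section Probability

variable {d : ℕ} {μ : Measure ℝ} {u : Site d → ℝ} {I : Set ℝ} {ε l m mL L W : ℝ} {n : ℕ}

theorem isUnifRegular_of_notMem_fourBadEvent {ω : Config d μ} {E : ℝ} (hE : E ∈ I) (hε : 0 < ε)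
    (hl : 1 ≤ l) {x : Site d} (hfour : ω ∉ fourBadEvent μ u l L x m I)
    (hres : ∀ r : ℕ, r ≤ ⌊L⌋₊ → ¬ PossiblyResonant u L x (cube r x) E ε ω)
    (hn : n * (l + 3) + 58 * l ≤ L)
    (hbound : ((2 * d * (3 * L) ^ d) ^ 2 * Real.exp (-(m * l)) / ε) ^ n * (1 / ε) ≤
      Real.exp (-(mL * L))) : IsUnifRegular u L x mL E ω := by
  have hn0 : 0 ≤ n * (l + 3) := by positivity
  obtain ⟨Z, hZ, hcover⟩ := exists_finset_of_not_exists_pairwise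
    (S := {z | z ∈ cube L x ∧ ¬ IsUnifRegular u l z m E ω})
    (far := fun z z' => 8 * l < ‖z - z'‖) (fun h => by rwa [norm_sub_rev]) 3
    fun ⟨z, hz, hfar⟩ => hfour ⟨E, hE, z, fun i => (hz i).1, hfar, fun i => (hz i).2⟩
  intro ω' hω'
  have hreg : ∀ z ∈ cube L x, (∀ c ∈ Z, 8 * l < ‖z - c‖) →
      HasGreenBound (potential u ω') (cube l z) E z (Real.exp (-(m * l))) := by
    intro z hz hfar
    have hunif : IsUnifRegular u l z m E ω := by
      by_contra hbad
      obtain ⟨c, hc, hzc⟩ := hcover z ⟨hz, hbad⟩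
      exact hzc (hfar c hc)
    exact isRegular_iff_hasGreenBound.1 <| hunif ω' fun k hk =>
      hω' k (cube_mono (by linarith) x (mem_cube_trans hk hz))
  have hsteps : n * (l + 3) + Z.card * (2 * (8 * l) + 3) + 1 ≤ L := by
    have hZ' : (Z.card : ℝ) ≤ 3 := by exact_mod_cast hZ
    have := mul_le_mul_of_nonneg_right hZ' (show 0 ≤ 2 * (8 * l) + 3 by linarith)
    linarith
  have hgreen := hasGreenBound_of_regular_subcubes hε hl (Real.exp_pos _).le (by linarith)
    (fun r hr hresr => hres r hr ⟨ω', hω', hresr⟩) hreg hsteps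
  exact isRegular_iff_hasGreenBound.2 ⟨hgreen.1, fun w hw => (hgreen.2 w hw).trans hbound⟩

theorem badEvent_subset (hε : 0 < ε) (hl : 1 ≤ l) (x y : Site d) (hn : n * (l + 3) + 58 * l ≤ L)
    (hbound : ((2 * d * (3 * L) ^ d) ^ 2 * Real.exp (-(m * l)) / ε) ^ n * (1 / ε) ≤
      Real.exp (-(mL * L))) :
    badEvent μ u L x y mL I ⊆ (fourBadEvent μ u l L x m I ∪ fourBadEvent μ u l L y m I) ∪
      ⋃ p ∈ Finset.range (⌊L⌋₊ + 1) ×ˢ Finset.range (⌊L⌋₊ + 1),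
        commonResonanceEvent μ u L ε x y (cube p.1 x) (cube p.2 y) := by
  rintro ω ⟨E, hE, hx, hy⟩
  by_cases hfour : ω ∈ fourBadEvent μ u l L x m I ∪ fourBadEvent μ u l L y m I
  · exact Or.inl hfour
  have hresonant {z : Site d} (hz : ω ∉ fourBadEvent μ u l L z m I)
      (hreg : ¬ IsUnifRegular u L z mL E ω) :
      ∃ r ∈ Finset.range (⌊L⌋₊ + 1), PossiblyResonant u L z (cube r z) E ε ω := by
    by_contra! hnone
    exact hreg (isUnifRegular_of_notMem_fourBadEvent hE hε hl hz
      (fun r hr => hnone r (Finset.mem_range_succ_iff.2 hr)) hn hbound)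
  obtain ⟨r, hr, hrx⟩ := hresonant (fun h => hfour (Or.inl h)) hx
  obtain ⟨r', hr', hry⟩ := hresonant (fun h => hfour (Or.inr h)) hy
  exact Or.inr (mem_biUnion (x := (r, r')) (Finset.mem_product.2 ⟨hr, hr'⟩) ⟨E, hrx, hry⟩)

theorem measureReal_biUnion_commonResonanceEvent_le (hL : 1 ≤ L) {x y : Site d}
    (hW : ∀ S₁ ⊆ cube L x, ∀ S₂ ⊆ cube L y,
      (prob d μ).real (commonResonanceEvent μ u L ε x y S₁ S₂) ≤ W) :
    (prob d μ).real (⋃ p ∈ Finset.range (⌊L⌋₊ + 1) ×ˢ Finset.range (⌊L⌋₊ + 1),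
      commonResonanceEvent μ u L ε x y (cube p.1 x) (cube p.2 y)) ≤ (2 * L) ^ 2 * W := by
  have hW0 : 0 ≤ W := measureReal_nonneg.trans (hW ∅ (by simp) ∅ (by simp))
  have hfloor : (⌊L⌋₊ : ℝ) ≤ L := Nat.floor_le (by linarith)
  have hsub {r : ℕ} (hr : r ∈ Finset.range (⌊L⌋₊ + 1)) (z : Site d) :
      cube (r : ℝ) z ⊆ cube L z :=
    cube_mono ((Nat.cast_le.2 (Finset.mem_range_succ_iff.1 hr)).trans hfloor) z
  refine (measureReal_biUnion_finset_le _ _).trans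
    ((Finset.sum_le_card_nsmul _ _ W fun p hp => ?_).trans ?_)
  · obtain ⟨hr, hr'⟩ := Finset.mem_product.1 hp
    exact hW _ (hsub hr x) _ (hsub hr' y)
  · rw [nsmul_eq_mul, Finset.card_product, Finset.card_range, ← sq]
    push_cast
    gcongr
    linarith

variable [IsProbabilityMeasure μ] {ξ : ℝ}

theorem GEstimate.measureReal_badEvent_scale_le (hG : GEstimate μ u I l m ξ) (hu : ExpDecay u)
    (hμ : Bornology.IsBounded μ.support) (hI : IsSigmaCompact I) (hε : 0 < ε) (hl : 1 ≤ l)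
    (hn : n * (l + 3) + 58 * l ≤ L)
    (hbound : ((2 * d * (3 * L) ^ d) ^ 2 * Real.exp (-(m * l)) / ε) ^ n * (1 / ε) ≤
      Real.exp (-(mL * L))) {x y : Site d}
    (hW : ∀ S₁ ⊆ cube L x, ∀ S₂ ⊆ cube L y,
      (prob d μ).real (commonResonanceEvent μ u L ε x y S₁ S₂) ≤ W) :
    (prob d μ).real (badEvent μ u L x y mL I) ≤
      2 * ((3 * L) ^ d) ^ 4 * (l ^ (-(2 * ξ))) ^ 2 + (2 * L) ^ 2 * W := by
  have hn0 : 0 ≤ n * (l + 3) := by positivity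
  have hL : 1 ≤ L := by linarith
  have hfour (z : Site d) : (prob d μ).real (fourBadEvent μ u l L z m I) ≤
      ((3 * L) ^ d) ^ 4 * (l ^ (-(2 * ξ))) ^ 2 := by
    refine (hG.measureReal_fourBadEvent_le hu hμ hI (by linarith) z).trans ?_
    gcongr
    exact card_le_of_subset_cube (by linarith) le_rfl hL subset_rfl
  have hresonance := measureReal_biUnion_commonResonanceEvent_le hL hW
  have hunion := (measureReal_mono (μ := prob d μ)
    (badEvent_subset (u := u) (I := I) hε hl x y hn hbound)).trans (measureReal_union_le _ _)
  have hunion_four := measureReal_union_le (μ := prob d μ) (fourBadEvent μ u l L x m I)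
    (fourBadEvent μ u l L y m I)
  linarith [hfour x, hfour y]

theorem GEstimate.scale_up (hG : GEstimate μ u I l m ξ) (hu : ExpDecay u)
    (hμ : Bornology.IsBounded μ.support) (hI : IsSigmaCompact I) (hε : 0 < ε) (hl : 1 ≤ l)
    (hn : n * (l + 3) + 58 * l ≤ L)
    (hbound : ((2 * d * (3 * L) ^ d) ^ 2 * Real.exp (-(m * l)) / ε) ^ n * (1 / ε) ≤
      Real.exp (-(mL * L)))
    (hW : ∀ x y : Site d, Disjoint (cube (4 * L) x) (cube (4 * L) y) →
      ∀ S₁ ⊆ cube L x, ∀ S₂ ⊆ cube L y,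
      (prob d μ).real (commonResonanceEvent μ u L ε x y S₁ S₂) ≤ W)
    (hsmall : 2 * ((3 * L) ^ d) ^ 4 * (l ^ (-(2 * ξ))) ^ 2 + (2 * L) ^ 2 * W ≤ L ^ (-(2 * ξ))) :
    GEstimate μ u I L mL ξ := by
  have hn0 : 0 ≤ n * (l + 3) := by positivity
  have hL : 0 ≤ L := by linarith
  intro x y hxy
  rw [probReal_compl_eq_one_sub (measurableSet_badEvent hu hμ hL x y mL hI)]
  linarith [hG.measureReal_badEvent_scale_le hu hμ hI hε hl hn hbound
    (hW x y (disjoint_cube_of_lt hL hxy))]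

end Probability

section Scales

open Filter

theorem pow_mul_exp_le_exp {q a s : ℝ} (n : ℕ) (hq : 0 ≤ q) (hqs : q ≤ Real.exp s) :
    (q * Real.exp (-a) / Real.exp (-s)) ^ n * (1 / Real.exp (-s)) ≤
      Real.exp (n * (2 * s - a) + s) := by
  have hbase : q * Real.exp (-a) / Real.exp (-s) ≤ Real.exp (2 * s - a) :=
    calc q * Real.exp (-a) / Real.exp (-s)
        ≤ Real.exp s * Real.exp (-a) / Real.exp (-s) := by gcongr
      _ = Real.exp (2 * s - a) := by
        rw [← Real.exp_add, ← Real.exp_sub]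
        ring_nf
  calc (q * Real.exp (-a) / Real.exp (-s)) ^ n * (1 / Real.exp (-s))
      ≤ Real.exp (2 * s - a) ^ n * (1 / Real.exp (-s)) := by gcongr
    _ = Real.exp (n * (2 * s - a) + s) := by
      rw [← Real.exp_nat_mul, one_div, ← Real.exp_neg, neg_neg, ← Real.exp_add]

theorem exists_step_count {l L m h s q : ℝ} (hl : 1 ≤ l) (hm : 0 ≤ m) (hs : 0 ≤ s) (hq : 0 ≤ q)
    (hqs : q ≤ Real.exp s) (hlL : 58 * l ≤ L) (hloss : 62 * l + 3 * (L / l) ≤ L * h / 2)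
    (hwidth : 3 * s * (L / l) ≤ L * h / 2) :
    ∃ n : ℕ, n * (l + 3) + 58 * l ≤ L ∧
      (q * Real.exp (-(m * l)) / Real.exp (-s)) ^ n * (1 / Real.exp (-s)) ≤
        Real.exp (-((m * (1 - h / 2) - h / 2) * L)) := by
  have hl0 : 0 < l := by linarith
  have hl3 : 0 < l + 3 := by linarith
  set n := ⌊(L - 58 * l) / (l + 3)⌋₊
  have hn_le : n * (l + 3) ≤ L - 58 * l :=
    (le_div_iff₀ hl3).1 (Nat.floor_le (div_nonneg (by linarith) hl3.le))
  have hn_lt : L - 58 * l < (n + 1) * (l + 3) := (div_lt_iff₀ hl3).1 (Nat.lt_floor_add_one _)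
  have hn_ratio : (n : ℝ) ≤ L / l := by
    rw [le_div_iff₀ hl0]
    linarith [n.cast_nonneg (α := ℝ)]
  have hratio : 1 ≤ L / l := by
    rw [le_div_iff₀ hl0]
    linarith
  refine ⟨n, by linarith, (pow_mul_exp_le_exp n hq hqs).trans (Real.exp_le_exp.2 ?_)⟩
  have hcost : 2 * s * n + s ≤ L * h / 2 :=
    calc 2 * s * n + s ≤ 2 * s * (L / l) + s * (L / l) := by
          gcongr
          exact le_mul_of_one_le_right hs hratio
      _ = 3 * s * (L / l) := by ring
      _ ≤ L * h / 2 := hwidth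
  have hgain : m * (L * (1 - h / 2)) ≤ m * (n * l) :=
    mul_le_mul_of_nonneg_left (by linarith) hm
  linarith

theorem scaled_mass_bounds {m h : ℝ} (h0 : 0 < h) (hh : h ≤ 1 / 2) (hm : h < m) :
    h / 4 < m * (1 - h / 2) - h / 2 ∧ m * (1 - h / 2) - h / 2 < m ∧
      m * (1 - h) - h < m * (1 - h / 2) - h / 2 := by
  have hmh : 0 < m * h := mul_pos (h0.trans hm) h0
  exact ⟨by nlinarith, by linarith, by linarith⟩

theorem eventually_mul_rpow_le_rpow (A : ℝ) {a b : ℝ} (hab : a < b) :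
    ∀ᶠ l : ℝ in atTop, A * l ^ a ≤ l ^ b := by
  filter_upwards [(tendsto_rpow_atTop (sub_pos.2 hab)).eventually_ge_atTop A,
    eventually_gt_atTop 0] with l hA hl
  calc A * l ^ a ≤ l ^ (b - a) * l ^ a := by gcongr
    _ = l ^ b := by rw [← Real.rpow_add hl, sub_add_cancel]

theorem eventually_mul_rpow_le_exp (A q : ℝ) {s c : ℝ} (hs : 0 < s) (hc : 0 < c) :
    ∀ᶠ l : ℝ in atTop, A * l ^ q ≤ Real.exp (c * l ^ s) := by
  have hlittle := (isLittleO_rpow_exp_pos_mul_atTop ((q + 1) / s) hc).bound one_pos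
  filter_upwards [(tendsto_rpow_atTop hs).eventually hlittle, eventually_ge_atTop A,
    eventually_gt_atTop 0] with l hbound hA hl
  rw [one_mul, Real.norm_eq_abs, Real.norm_eq_abs, Real.abs_exp, ← Real.rpow_mul hl.le,
    mul_div_cancel₀ _ hs.ne', abs_of_nonneg (by positivity)] at hbound
  calc A * l ^ q ≤ l * l ^ q := by gcongr
    _ = l ^ (q + 1) := by rw [Real.rpow_add_one hl.ne', mul_comm]
    _ ≤ Real.exp (c * l ^ s) := hbound

theorem eventually_step_count_bounds {κ β : ℝ} (hκ : 1 < κ) (hβ : 2 - κ < β) (hβ0 : 0 < β) :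
    ∀ᶠ l : ℝ in atTop, 58 * l ≤ l ^ κ ∧
      62 * l + 3 * (l ^ κ / l) ≤ l ^ κ * l ^ (β - 1) / 2 ∧
      3 * l ^ (β / 2) * (l ^ κ / l) ≤ l ^ κ * l ^ (β - 1) / 2 := by
  filter_upwards [eventually_mul_rpow_le_rpow 58 hκ,
    eventually_mul_rpow_le_rpow 248 (show 1 < κ + (β - 1) by linarith),
    eventually_mul_rpow_le_rpow 12 (show κ - 1 < κ + (β - 1) by linarith),
    eventually_mul_rpow_le_rpow 6 (show β / 2 + (κ - 1) < κ + (β - 1) by linarith),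
    eventually_gt_atTop 0] with l hscale hloss hratio hwidth hl
  rw [Real.rpow_one] at hscale hloss
  rw [← Real.rpow_add hl, ← Real.rpow_sub_one hl.ne', mul_assoc, ← Real.rpow_add hl]
  exact ⟨hscale, by linarith, by linarith⟩

theorem eventually_mass_bounds {κ β : ℝ} (hκ : 1 < κ) (hβ : β < 1) :
    ∀ᶠ l : ℝ in atTop, l ^ (β - 1) ≤ 1 / 2 ∧ 4 * (l ^ κ) ^ (β - 1) ≤ l ^ (β - 1) := by
  filter_upwards [eventually_mul_rpow_le_rpow 2 (show β - 1 < 0 by linarith),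
    eventually_mul_rpow_le_rpow 4 (show κ * (β - 1) < β - 1 by nlinarith),
    eventually_gt_atTop 0] with l hhalf hquarter hl
  rw [Real.rpow_zero] at hhalf
  rw [← Real.rpow_mul hl.le]
  exact ⟨by linarith, hquarter⟩

theorem eventually_four_bad_bound {ξ κ : ℝ} (d : ℕ) (hξκ : κ * (ξ + 2 * d) < 2 * ξ) :
    ∀ᶠ l : ℝ in atTop, 2 * ((3 * l ^ κ) ^ d) ^ 4 * (l ^ (-(2 * ξ))) ^ 2 ≤
      (l ^ κ) ^ (-(2 * ξ)) / 2 := by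
  have hexp : κ * (d * 4 : ℕ) + -(2 * ξ) * (2 : ℕ) < κ * -(2 * ξ) := by
    push_cast
    linarith
  filter_upwards [eventually_mul_rpow_le_rpow (4 * 3 ^ (d * 4)) hexp, eventually_gt_atTop 0]
    with l hbound hl
  rw [Real.rpow_add hl, Real.rpow_mul_natCast hl.le, Real.rpow_mul_natCast hl.le,
    Real.rpow_mul hl.le] at hbound
  rw [← pow_mul, mul_pow]
  linarith

theorem eventually_resonance_bound {ξ κ β : ℝ} (D : ℝ) (p : ℕ) (hβ : 0 < β) :
    ∀ᶠ l : ℝ in atTop,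
      (2 * l ^ κ) ^ 2 * (D * (l ^ κ) ^ p * √(Real.exp (-l ^ (β / 2)))) ≤
      (l ^ κ) ^ (-(2 * ξ)) / 2 := by
  filter_upwards [eventually_mul_rpow_le_exp (8 * D) (κ * (2 + p : ℕ) + κ * (2 * ξ))
    (half_pos hβ) one_half_pos, eventually_gt_atTop 0] with l hbound hl
  rw [Real.rpow_add hl, Real.rpow_mul_natCast hl.le, Real.rpow_mul hl.le] at hbound
  have hL : 0 < l ^ κ := Real.rpow_pos_of_pos hl κ
  have hsqrt : √(Real.exp (-l ^ (β / 2))) = (Real.exp (1 / 2 * l ^ (β / 2)))⁻¹ := by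
    rw [← Real.exp_half, ← Real.exp_neg]
    ring_nf
  calc (2 * l ^ κ) ^ 2 * (D * (l ^ κ) ^ p * √(Real.exp (-l ^ (β / 2))))
      = 8 * D * ((l ^ κ) ^ (2 + p) * (l ^ κ) ^ (2 * ξ)) / Real.exp (1 / 2 * l ^ (β / 2)) *
          ((l ^ κ) ^ (2 * ξ))⁻¹ / 2 := by
        rw [hsqrt]
        field_simp
        ring
    _ ≤ 1 * ((l ^ κ) ^ (2 * ξ))⁻¹ / 2 := by
        gcongr
        exact (div_le_one (Real.exp_pos _)).2 hbound
    _ = (l ^ κ) ^ (-(2 * ξ)) / 2 := by rw [one_mul, Real.rpow_neg hL.le]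

theorem eventually_volume_le_exp {β : ℝ} (κ : ℝ) (d : ℕ) (hβ : 0 < β) :
    ∀ᶠ l : ℝ in atTop, (2 * d * (3 * l ^ κ) ^ d) ^ 2 ≤ Real.exp (l ^ (β / 2)) := by
  filter_upwards [eventually_mul_rpow_le_exp ((2 * d * 3 ^ d) ^ 2) (κ * (d * 2 : ℕ))
    (half_pos hβ) one_pos, eventually_gt_atTop 0] with l hvolume hl
  rw [one_mul, Real.rpow_mul_natCast hl.le] at hvolume
  calc (2 * d * (3 * l ^ κ) ^ d) ^ 2 = (2 * d * 3 ^ d) ^ 2 * (l ^ κ) ^ (d * 2) := by ring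
    _ ≤ Real.exp (l ^ (β / 2)) := hvolume

theorem eventually_width_bounds {κ β : ℝ} (K L₀ : ℝ) {c : ℝ} (hc : 0 < c) (hκ : 0 < κ)
    (hβ : 0 < β) (hβκ : β / 2 < κ) :
    ∀ᶠ l : ℝ in atTop, L₀ ≤ l ^ κ ∧ K * Real.exp (-c * l ^ κ) ≤ Real.exp (-l ^ (β / 2)) ∧
      Real.exp (-l ^ (β / 2)) ≤ 1 / 2 := by
  filter_upwards [eventually_mul_rpow_le_rpow L₀ hκ, eventually_mul_rpow_le_rpow (2 / c) hβκ,
    eventually_mul_rpow_le_exp K 0 hκ (half_pos hc),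
    eventually_mul_rpow_le_exp 2 0 (half_pos hβ) one_pos] with l hL₀ hexponent hK htwo
  rw [Real.rpow_zero, mul_one] at hL₀ hK htwo
  rw [one_mul] at htwo
  refine ⟨hL₀, ?_, ?_⟩
  · rw [div_mul_eq_mul_div, div_le_iff₀ hc] at hexponent
    calc K * Real.exp (-c * l ^ κ)
        ≤ Real.exp (c / 2 * l ^ κ) * Real.exp (-c * l ^ κ) := by gcongr
      _ = Real.exp (-(c / 2 * l ^ κ)) := by
        rw [← Real.exp_add]
        ring_nf
      _ ≤ Real.exp (-l ^ (β / 2)) := Real.exp_le_exp.2 (by linarith)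
  · rw [Real.exp_neg, ← one_div]
    exact one_div_le_one_div_of_le two_pos htwo

theorem eventually_exists_step_count_and_mass {κ β : ℝ} (d : ℕ) (hκ : 1 < κ)
    (hβ : β ∈ Ioo (2 - κ) 1) (hβ0 : 0 < β) :
    ∀ᶠ l : ℝ in atTop, ∀ m, l ^ (β - 1) < m → ∃ (n : ℕ) (mL : ℝ), 0 < mL ∧ mL < m ∧
      m * (1 - l ^ (β - 1)) - l ^ (β - 1) < mL ∧ (l ^ κ) ^ (β - 1) < mL ∧
      n * (l + 3) + 58 * l ≤ l ^ κ ∧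
      ((2 * d * (3 * l ^ κ) ^ d) ^ 2 * Real.exp (-(m * l)) / Real.exp (-l ^ (β / 2))) ^ n *
        (1 / Real.exp (-l ^ (β / 2))) ≤ Real.exp (-(mL * l ^ κ)) := by
  filter_upwards [eventually_step_count_bounds hκ hβ.1 hβ0, eventually_mass_bounds hκ hβ.2,
    eventually_volume_le_exp κ d hβ0, eventually_ge_atTop 1]
    with l ⟨hscale, hloss, hwidth⟩ ⟨hhalf, hquarter⟩ hvolume hl m hm
  have hpow : 0 < l ^ (β - 1) := by positivity
  obtain ⟨n, hn, hbound⟩ := exists_step_count hl (hpow.trans hm).le (by positivity)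
    (sq_nonneg _) hvolume hscale hloss hwidth
  obtain ⟨hlow, hup, hdrop⟩ := scaled_mass_bounds hpow hhalf hm
  exact ⟨n, m * (1 - l ^ (β - 1) / 2) - l ^ (β - 1) / 2, by linarith, hup, hdrop, by linarith,
    hn, hbound⟩

end Scales

end AlloyMSA

open AlloyMSA

theorem theorem6p1_general (d : ℕ) (u : Site d → ℝ) (hu : ExpDecay u) (hu0 : u ≠ 0)
    (μ : Measure ℝ) [IsProbabilityMeasure μ] (hμ : Bornology.IsBounded μ.support)
    (ρ : ℝ → ℝ) (hρ : IsDensity μ ρ) (hBV : IsBV ρ) (ξ κ β : ℝ) (hξ : 2 * (d : ℝ) < ξ)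
    (hκ : κ ∈ Ioo 1 (2 * ξ / (ξ + 2 * (d : ℝ)))) (hβ : β ∈ Ioo (2 - κ) 1) :
    ∃ lstar : ℝ, 1 ≤ lstar ∧
      ∀ (I : Set ℝ) (l m L : ℝ), IsSigmaCompact I → lstar ≤ l → l ^ (β - 1) < m → L = l ^ κ →
        GEstimate μ u I l m ξ →
        ∃ mL : ℝ, 0 < mL ∧ mL < m ∧
          m * (1 - L ^ (-((1 - β) / κ))) - L ^ (-((1 - β) / κ)) < mL ∧
          L ^ (β - 1) < mL ∧ GEstimate μ u I L mL ξ := by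
  have hd0 : (0 : ℝ) ≤ d := d.cast_nonneg
  have hξκ : κ * (ξ + 2 * d) < 2 * ξ := (lt_div_iff₀ (by linarith [hd0])).1 hκ.2
  have hβ0 : 0 < β := by nlinarith [hκ.1, hβ.1]
  obtain ⟨V, hV⟩ := exists_isTranslationLipschitz hρ hBV
  obtain ⟨D, K, c, L₀, p, -, -, hc, -, hwegner⟩ := exists_wegner hu hu0 hμ hV
  obtain ⟨lstar, hlstar⟩ := Filter.eventually_atTop.1 <|
    (Filter.eventually_ge_atTop 1).and <|
    (eventually_exists_step_count_and_mass d hκ.1 hβ hβ0).and <|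
    (eventually_four_bad_bound d hξκ).and <|
    (eventually_resonance_bound (ξ := ξ) (κ := κ) D p hβ0).and <|
    eventually_width_bounds (κ := κ) K L₀ hc (by linarith [hκ.1]) hβ0 (by linarith [hκ.1, hβ.2])
  refine ⟨lstar, (hlstar lstar le_rfl).1, ?_⟩
  rintro I l m _ hI hl hm rfl hG
  obtain ⟨hl1, hmass, hfour, hresonance, hL₀, hε, hε_half⟩ := hlstar l hl
  obtain ⟨n, mL, hmL, hup, hdrop, hlow, hn, hbound⟩ := hmass m hm
  have hscaled : (l ^ κ) ^ (-((1 - β) / κ)) = l ^ (β - 1) := by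
    rw [← Real.rpow_mul (by linarith), mul_neg, mul_div_cancel₀ _ (by linarith [hκ.1]), neg_sub]
  rw [hscaled]
  exact ⟨mL, hmL, hup, hdrop, hlow, hG.scale_up hu hμ hI (Real.exp_pos _) hl1 hn hbound
    (hwegner _ hL₀ _ hε hε_half) (by linarith)⟩

theorem theorem6p1 (d : ℕ) (hd : 1 ≤ d)
    (u : AlloyMSA.Site d → ℝ) (hu : AlloyMSA.ExpDecay u) (hu0 : u ≠ 0)
    (μ : Measure ℝ) [IsProbabilityMeasure μ] (hμ : Bornology.IsBounded μ.support)
    (ρ : ℝ → ℝ) (hρ : AlloyMSA.IsDensity μ ρ) (hBV : AlloyMSA.IsBV ρ)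
    (ξ κ β : ℝ) (hξ : 2 * (d : ℝ) < ξ)
    (hκ : κ ∈ Set.Ioo 1 (2 * ξ / (ξ + 2 * (d : ℝ)))) (hβ : β ∈ Set.Ioo (2 - κ) 1) :
    ∃ lstar : ℝ, 1 ≤ lstar ∧
      ∀ (I : Set ℝ) (l m L : ℝ), I.OrdConnected → lstar ≤ l → l ^ (β - 1) < m → L = l ^ κ →
        AlloyMSA.GEstimate μ u I l m ξ →
        ∃ mL : ℝ, 0 < mL ∧ mL < m ∧
          m * (1 - L ^ (-((1 - β) / κ))) - L ^ (-((1 - β) / κ)) < mL ∧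
          L ^ (β - 1) < mL ∧
          AlloyMSA.GEstimate μ u I L mL ξ := by
  obtain ⟨lstar, hlstar, h⟩ := theorem6p1_general d u hu hu0 μ hμ ρ hρ hBV ξ κ β hξ hκ hβ
  exact ⟨lstar, hlstar, fun I l m L hI => h I l m L (isSigmaCompact_of_ordConnected hI)⟩
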